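/- **Setting.** All vocabularies are relational, structures are finite with nonempty universe, and logic is without equality. A pp-formula is built from $\top$ and atoms $R(x_1,\dots,x_n)$ using $\wedge$ and $\exists$. A prenex pp-formula is given as a pair $\phi=(\mathbf A,S)$, where $\mathbf A$ is a structure whose universe $A$ is a finite set of variables and which has finitely many tuples in its relations, and $S\subseteq A$ is the set of liberal variables; it stands for the formula that quantifies the variables in $A\setminus S$ existentially over the conjunction of all atoms $R(a_1,\dots,a_n)$ with $(a_1,\dots,a_n)\in R^{\mathbf A}$. For a structure $\mathbf B$ over the same vocabulary, $\phi(\mathbf B)$ is the set of maps $S\to B$ that satisfy $\phi$, i.e. that extend to a homomorphism $\mathbf A\to\mathbf B$. The graph $G$ of $(\mathbf A,S)$ has vertex set $A$, two distinct vertices being adjacent if they appear together in a tuple of a relation of $\mathbf A$. For each connected component $V$ of $G[A\setminus S]$, the set $V$ together with all vertices of $S$ having an edge to $V$ is the vertex set of an $\exists$-component. The graph $\mathrm{contract}(\mathbf A,S)$ has vertex set $S$ and is obtained from $G[S]$ by adding an edge between any two distinct vertices of $S$ that lie in a common $\exists$-component. A core of $(\mathbf A,S)$ is $(c(\mathbf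 A),S)$, where $c$ is an endomorphism of $\mathbf A$ that fixes each element of $S$ and has minimum image size among these, $c(\mathbf A)$ having universe $c(A)$ and relations $c(R^{\mathbf A})$; it is unique up to isomorphism. The width of a tree decomposition is the maximum size of a bag minus $1$, and the treewidth of a graph is the minimum width of its tree decompositions. A class $\Phi$ of prenex pp-formulas (possibly over different vocabularies) satisfies the *contraction condition* if the graphs $\mathrm{contract}(\psi)$, where $\psi$ is a core of a formula in $\Phi$, have bounded treewidth. It satisfies the *tractability condition* if it satisfies the contraction condition and, moreover, the graphs of the cores of formulas in $\Phi$ have bounded treewidth. $\sharp\mathsf{PP}$-formulas, with their free and closed variables, are defined inductively ($V$ denotes a finite set of variables): - $C(\phi,V)$, for a pp-formula $\phi$ and $V\supseteq\mathrm{free}(\phi)$; free variables $V$, closed variables $\emptyset$; - $PV\psi$, if $V\cap\mathrm{closed}(\psi)=\emptyset$; free variables $\mathrm{free}(\psi)\setminus V$, closed variables $V\cup\mathrm{closed}(\psi)$; - $EV\psi$, if $V\cap(\mathrm{free}(\psi)\cup\mathrm{closed}(\psi))=\emptyset$; free variables $V\cup\mathrm{free}(\psi)$, closed variables $\mathrm{closed}(\psi)$;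 - $\psi\times\theta$, if $\mathrm{free}(\psi)=\mathrm{free}(\theta)$ and $\mathrm{closed}(\psi)\cap\mathrm{closed}(\theta)=\emptyset$; free variables $\mathrm{free}(\psi)$, closed variables $\mathrm{closed}(\psi)\cup\mathrm{closed}(\theta)$; - $\psi+\theta$, if $\mathrm{free}(\psi)=\mathrm{free}(\theta)$; free variables $\mathrm{free}(\psi)$, closed variables $\mathrm{closed}(\psi)\cup\mathrm{closed}(\theta)$; - $n\in\mathbb Z$; no free and no closed variables. The value $[\mathbf B,\psi](h)\in\mathbb Z$, for $h:\mathrm{free}(\psi)\to B$, is: for $C(\phi,V)$, $1$ if $\mathbf B,h\models\phi$ and $0$ otherwise; for $PV\psi$, the sum of $[\mathbf B,\psi](h')$ over all extensions $h':\mathrm{free}(\psi)\cup V\to B$ of $h$ (where $\psi$ is evaluated at the restriction of $h'$ to $\mathrm{free}(\psi)$); for $EV\psi$, $[\mathbf B,\psi](h|_{\mathrm{free}(\psi)})$; for $\times$ and $+$, the product and the sum; for $n$, the number $n$. For a $\sharp\mathsf{PP}$-formula $\psi$, $\sharp\text{-}\mathrm{width}(\psi)$ is the maximum of $|\mathrm{free}(\theta)|$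 over all $\sharp$-subformulas $\theta$ of $\psi$, and $\mathrm{width}(\psi)$ is the maximum of $|\mathrm{free}(\theta)|$ over all $\theta$ that are $\sharp$-subformulas of $\psi$ or subformulas of a pp-formula $\phi$ for which $C(\phi,V)$ occurs in $\psi$. A *$\sharp\mathsf{PP}$-representation* of a prenex pp-formula $\phi$ is a $\sharp\mathsf{PP}$-formula $\psi$ over the same vocabulary without free variables such that $[\mathbf B,\psi]=|\phi(\mathbf B)|$ for every finite structure $\mathbf B$. **Theorem.** Let $\Phi$ be a class of prenex pp-formulas. 1. $\Phi$ satisfies the tractability condition if and only if there exists $k\ge 1$ such that each formula in $\Phi$ has a $\sharp\mathsf{PP}$-representation $\phi'$ with $\mathrm{width}(\phi')\le k$. 2. $\Phi$ satisfies the contraction condition if and only if there exists $k\ge 1$ such that each formula in $\Phi$ has a $\sharp\mathsf{PP}$-representation $\phi'$ with $\sharp\text{-}\mathrm{width}(\phi')\le k$. -/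

import Mathlib

universe u v

namespace SharpLogic

/-! ### Tree decompositions and treewidth -/

/-- A tree decomposition of a graph: a finite tree with a bag of vertices at every node, such that
the nodes whose bag contains a given vertex form a nonempty connected set (`Connected` includes
nonemptiness), and every edge is contained in some bag. -/
structure TreeDecomposition {V : Type u} (G : SimpleGraph V) where
  node : Type
  [nodeFintype : Fintype node]
  tree : SimpleGraph node
  isTree : tree.IsTree
  bag : node → Finset V
  connected : ∀ x : V, (tree.induce {t | x ∈ bag t}).Connected
  edge : ∀ x y : V, G.Adj x y → ∃ t, x ∈ bag t ∧ y ∈ bag t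

/-- The maximum size of a bag, minus one (an integer, equal to `-1` when all bags are empty). -/
def TreeDecomposition.width {V : Type u} {G : SimpleGraph V} (D : TreeDecomposition G) : ℤ :=
  letI := D.nodeFintype
  ((Finset.univ.sup fun t => (D.bag t).card : ℕ) : ℤ) - 1

/-- The minimum width of a tree decomposition. For a finite graph the set of widths is nonempty
and bounded below by `-1`, so that the infimum is attained. -/
noncomputable def treewidth {V : Type u} (G : SimpleGraph V) : ℤ :=
  sInf (Set.range fun D : TreeDecomposition G => D.width)

/-- A class of graphs has bounded treewidth. -/
def BoundedTreewidth (C : Set (Σ V : Type, SimpleGraph V)) : Prop :=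
  ∃ k : ℤ, ∀ G ∈ C, treewidth G.2 ≤ k

/-! ### Vocabularies and primitive positive formulas

Variables are natural numbers. -/

/-- A relational vocabulary: a first-order language without function symbols. -/
abbrev Vocabulary : Type (v + 1) := {L : FirstOrder.Language.{0, v} // L.IsRelational}

/-- Primitive positive formulas (without equality), with named variables. -/
inductive PPFormula (L : FirstOrder.Language.{0, v}) : Type v
  | top : PPFormula L
  | rel {n : ℕ} (R : L.Relations n) (x : Fin n → ℕ) : PPFormula L
  | and (φ ψ : PPFormula L) : PPFormula L
  | ex (x : ℕ) (φ : PPFormula L) : PPFormula L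

namespace PPFormula

variable {L : FirstOrder.Language.{0, v}}

/-- The set of free variables. -/
def free : PPFormula L → Finset ℕ
  | top => ∅
  | rel _ x => Finset.univ.image x
  | and φ ψ => φ.free ∪ ψ.free
  | ex x φ => φ.free.erase x

/-- The maximum number of free variables of a subformula. -/
def width : PPFormula L → ℕ
  | top => 0
  | rel R x => (rel R x).free.card
  | and φ ψ => max (and φ ψ).free.card (max φ.width ψ.width)
  | ex x φ => max (ex x φ).free.card φ.width

/-- Satisfaction in a structure under an assignment of values to the variables; only the values at
the free variables matter. -/
def Sat {B : Type} [L.Structure B] : PPFormula L → (ℕ → B) → Prop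
  | top, _ => True
  | rel R x, h => FirstOrder.Language.Structure.RelMap R (h ∘ x)
  | and φ ψ, h => φ.Sat h ∧ ψ.Sat h
  | ex x φ, h => ∃ b : B, φ.Sat (Function.update h x b)

end PPFormula

/-! ### Prenex pp-formulas, as pairs of a structure and a set of liberal variables -/

/-- An atom `R(x₁, …, xₙ)`. -/
structure Atom (L : FirstOrder.Language.{0, v}) where
  arity : ℕ
  rel : L.Relations arity
  args : Fin arity → ℕ

/-- Apply a map of variables to each entry of an atom. -/
def Atom.map {L : FirstOrder.Language.{0, v}} (c : ℕ → ℕ) (a : Atom L) : Atom L :=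
  ⟨a.arity, a.rel, c ∘ a.args⟩

/-- A prenex pp-formula, viewed as a pair `(A, S)`: the structure `A` has universe `dom` and its
relations consist of the tuples in `atoms`; `S = lib` is the set of liberal variables. It stands
for the formula in which the variables of `dom \ lib` are existentially quantified in front of the
conjunction of `atoms`. -/
structure PrenexPP (L : FirstOrder.Language.{0, v}) where
  dom : Finset ℕ
  lib : Finset ℕ
  lib_subset : lib ⊆ dom
  atoms : Finset (Atom L)
  args_mem : ∀ a ∈ atoms, ∀ i, a.args i ∈ dom

namespace PrenexPP

variable {L : FirstOrder.Language.{0, v}}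

/-- The set of satisfying assignments `lib → B` on a structure `B`: those that extend to an
assignment of all variables that satisfies every atom. -/
def answers (φ : PrenexPP L) (B : Type) [L.Structure B] : Set (φ.lib → B) :=
  {f | ∃ g : φ.dom → B, (∀ s : φ.lib, g ⟨s, φ.lib_subset s.2⟩ = f s) ∧
    ∀ (a : Atom L) (ha : a ∈ φ.atoms),
      FirstOrder.Language.Structure.RelMap a.rel fun i => g ⟨a.args i, φ.args_mem a ha i⟩}

/-- The graph of a prenex pp-formula: its vertices are the variables, two of which are adjacent
if they are distinct and appear together in an atom. -/
def graph (φ : PrenexPP L) : SimpleGraph φ.dom where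
  Adj x y := x ≠ y ∧ ∃ a ∈ φ.atoms, (∃ i, a.args i = x) ∧ ∃ j, a.args j = y
  symm := ⟨fun _ _ ⟨hne, a, ha, hx, hy⟩ => ⟨hne.symm, a, ha, hy, hx⟩⟩
  loopless := ⟨fun _ h => h.1 rfl⟩

/-- The quantified variables (those that are not liberal). -/
def quantified (φ : PrenexPP L) : Set φ.dom := {x | (x : ℕ) ∉ φ.lib}

/-- The vertex set of the `∃`-component given by a connected component `V` of the subgraph induced
by the quantified variables: it consists of `V` and of all liberal variables having an edge
to `V`. -/
def existsComponent (φ : PrenexPP L)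
    (V : (φ.graph.induce φ.quantified).ConnectedComponent) : Set φ.dom :=
  {x | (∃ y ∈ V.supp, (y : φ.dom) = x) ∨ ((x : ℕ) ∈ φ.lib ∧ ∃ y ∈ V.supp, φ.graph.Adj x y)}

/-- A liberal variable as an element of the universe. -/
def ofLib (φ : PrenexPP L) (s : φ.lib) : φ.dom := ⟨s, φ.lib_subset s.2⟩

/-- The contraction: the graph on the liberal variables obtained from the induced subgraph by
joining any two vertices that appear together in an `∃`-component. -/
def contract (φ : PrenexPP L) : SimpleGraph φ.lib where
  Adj s t := s ≠ t ∧ (φ.graph.Adj (φ.ofLib s) (φ.ofLib t) ∨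
    ∃ V, φ.ofLib s ∈ φ.existsComponent V ∧ φ.ofLib t ∈ φ.existsComponent V)
  symm := ⟨fun _ _ ⟨hne, h⟩ =>
    ⟨hne.symm, h.imp (fun e => e.symm) fun ⟨V, hs, ht⟩ => ⟨V, ht, hs⟩⟩⟩
  loopless := ⟨fun _ h => h.1 rfl⟩

/-- `c` restricts to an endomorphism of the structure that fixes every liberal variable. -/
structure IsFixingEndo (φ : PrenexPP L) (c : ℕ → ℕ) : Prop where
  mapsTo : ∀ x ∈ φ.dom, c x ∈ φ.dom
  hom : ∀ a ∈ φ.atoms, a.map c ∈ φ.atoms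
  fixes : ∀ s ∈ φ.lib, c s = s

/-- `ψ` is a core of `φ`: the image of `φ` under an endomorphism that fixes every liberal variable
and has minimum image size among all such endomorphisms. -/
def IsCore (ψ φ : PrenexPP L) : Prop :=
  ∃ c : ℕ → ℕ, φ.IsFixingEndo c ∧
    (∀ d : ℕ → ℕ, φ.IsFixingEndo d → (φ.dom.image c).card ≤ (φ.dom.image d).card) ∧
    ψ.lib = φ.lib ∧ ψ.dom = φ.dom.image c ∧
    (ψ.atoms : Set (Atom L)) = Atom.map c '' (φ.atoms : Set (Atom L))

end PrenexPP

/-- A class of prenex pp-formulas; different members may be over different vocabularies. -/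
abbrev PPClass : Type (v + 1) := Set (Σ τ : Vocabulary.{v}, PrenexPP τ.1)

/-- The contractions of the cores of the formulas in the class have bounded treewidth. -/
def ContractionCondition (Φ : PPClass.{v}) : Prop :=
  BoundedTreewidth {G | ∃ p ∈ Φ, ∃ ψ : PrenexPP p.1.1, ψ.IsCore p.2 ∧ G = ⟨ψ.lib, ψ.contract⟩}

/-- The contraction condition holds, and moreover the cores of the formulas in the class have
bounded treewidth. -/
def TractabilityCondition (Φ : PPClass.{v}) : Prop :=
  ContractionCondition Φ ∧
    BoundedTreewidth {G | ∃ p ∈ Φ, ∃ ψ : PrenexPP p.1.1, ψ.IsCore p.2 ∧ G = ⟨ψ.dom, ψ.graph⟩}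

/-! ### `♯PP`-formulas -/

/-- Raw syntax of `♯PP`-formulas: the casting `C(φ, V)` of a pp-formula, the projection `P V ψ`,
the expansion `E V ψ`, products, sums and integer constants. -/
inductive SharpPP (L : FirstOrder.Language.{0, v}) : Type v
  | cast (φ : PPFormula L) (V : Finset ℕ) : SharpPP L
  | proj (V : Finset ℕ) (ψ : SharpPP L) : SharpPP L
  | expand (V : Finset ℕ) (ψ : SharpPP L) : SharpPP L
  | mul (ψ θ : SharpPP L) : SharpPP L
  | add (ψ θ : SharpPP L) : SharpPP L
  | const (n : ℤ) : SharpPP L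

namespace SharpPP

variable {L : FirstOrder.Language.{0, v}}

/-- The set of free variables. -/
def free : SharpPP L → Finset ℕ
  | cast _ V => V
  | proj V ψ => ψ.free \ V
  | expand V ψ => V ∪ ψ.free
  | mul ψ _ => ψ.free
  | add ψ _ => ψ.free
  | const _ => ∅

/-- The set of closed variables. -/
def closed : SharpPP L → Finset ℕ
  | cast _ _ => ∅
  | proj V ψ => V ∪ ψ.closed
  | expand _ ψ => ψ.closed
  | mul ψ θ => ψ.closed ∪ θ.closed
  | add ψ θ => ψ.closed ∪ θ.closed
  | const _ => ∅

/-- The formation rules. -/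
def WellFormed : SharpPP L → Prop
  | cast φ V => φ.free ⊆ V
  | proj V ψ => ψ.WellFormed ∧ Disjoint V ψ.closed
  | expand V ψ => ψ.WellFormed ∧ Disjoint V (ψ.free ∪ ψ.closed)
  | mul ψ θ => ψ.WellFormed ∧ θ.WellFormed ∧ ψ.free = θ.free ∧ Disjoint ψ.closed θ.closed
  | add ψ θ => ψ.WellFormed ∧ θ.WellFormed ∧ ψ.free = θ.free
  | const _ => True

/-- The maximum number of free variables of a `♯`-subformula. -/
def sharpWidth : SharpPP L → ℕ
  | cast φ V => (cast φ V).free.card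
  | proj V ψ => max (proj V ψ).free.card ψ.sharpWidth
  | expand V ψ => max (expand V ψ).free.card ψ.sharpWidth
  | mul ψ θ => max (mul ψ θ).free.card (max ψ.sharpWidth θ.sharpWidth)
  | add ψ θ => max (add ψ θ).free.card (max ψ.sharpWidth θ.sharpWidth)
  | const n => (const n : SharpPP L).free.card

/-- The maximum number of free variables of a subformula, where the subformulas are the
`♯`-subformulas together with the subformulas of the pp-formulas that are cast. -/
def width : SharpPP L → ℕ
  | cast φ V => max (cast φ V).free.card φ.width
  | proj V ψ => max (proj V ψ).free.card ψ.width
  | expand V ψ => max (expand V ψ).free.card ψ.width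
  | mul ψ θ => max (mul ψ θ).free.card (max ψ.width θ.width)
  | add ψ θ => max (add ψ θ).free.card (max ψ.width θ.width)
  | const n => (const n : SharpPP L).free.card

/-- The assignment that agrees with `g` on `V` and with `h` elsewhere. -/
def override {B : Type} (h : ℕ → B) (V : Finset ℕ) (g : V → B) : ℕ → B :=
  fun x => if hx : x ∈ V then g ⟨x, hx⟩ else h x

open Classical in
/-- The integer value of a formula on a finite structure under an assignment. For a well-formed
formula only the values at its free variables matter. For `P V ψ` the extensions of an assignment
on `free ψ \ V` to `free ψ ∪ V` correspond to the maps `g : V → B`; in particular each variable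
of `V` that is not free in `ψ` contributes a factor `|B|`. -/
noncomputable def eval {B : Type} [Fintype B] [L.Structure B] : SharpPP L → (ℕ → B) → ℤ
  | cast φ _, h => if φ.Sat h then 1 else 0
  | proj V ψ, h => ∑ g : V → B, ψ.eval (override h V g)
  | expand _ ψ, h => ψ.eval h
  | mul ψ θ, h => ψ.eval h * θ.eval h
  | add ψ θ, h => ψ.eval h + θ.eval h
  | const n, _ => n

/-- `ψ` is a `♯PP`-representation of `φ`: it is a (well-formed) `♯PP`-sentence whose value on
every finite structure is the number of satisfying assignments of `φ`. Structures have nonempty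
universes, as usual in first-order logic. As `ψ` has no free variables, its value does not depend
on the assignment `h`. -/
def Represents (ψ : SharpPP L) (φ : PrenexPP L) : Prop :=
  ψ.WellFormed ∧ ψ.free = ∅ ∧
    ∀ (B : Type) [Fintype B] [Nonempty B] [L.Structure B] (h : ℕ → B),
      ψ.eval h = ((φ.answers B).ncard : ℤ)

end SharpPP

end SharpLogic

/-! The syntax tree of a `♯PP`-formula and a tree decomposition are almost the same object, and both
are treated here as lists of bags built leaf by leaf (`RunningIntersection`).

From decompositions to formulas. A core has the same answers as the formula, so it suffices to
represent the core. Satisfaction splits into the atoms on liberal variables and one condition for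
each component of the quantified variables, which only depends on the liberal variables of its
`∃`-component (`PrenexPP.mem_answers_iff`). The scope of each condition is a clique of the
contraction, hence lies in a bag. The number of answers is therefore a sum, over assignments of the
liberal variables, of a product of 0/1 factors that each see one bag, and distributivity moves the
sums down the tree (`SharpPP.exists_sum_along`). The condition of a component is written as a
pp-formula of small width in the same way, along a decomposition of the graph of the core
(`PPFormula.exists_quantify_to`).

From formulas to decompositions. Multiplying out turns a representation into an integer linear
combination of basic formulas, without sums and constants and of no larger width; each basic
sentence counts the answers of one query. Such counts are multiplicative under direct products of
structures, so they are characters of a monoid, and distinct characters are linearly independent.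
Hence the count of the given formula equals the count of a single basic formula
(`Query.exists_count_eq_of_linearCombination`). Equal counts on all structures, blow-ups included,
force homomorphisms in both directions that are bijective on liberal variables
(`Query.exists_hom_of_count_eq`). By minimality of the core, one of them embeds it into the query of
the basic formula (`PrenexPP.IsCore.exists_injective`). The bags read off from the basic formula
then pull back to the core: all its variables are covered when `width` is bounded, the liberal ones
when `sharpWidth` is. -/

namespace SharpLogic

/-! ### Lists of bags with the running intersection property -/

/-- A list of bags, starting from a root bag at its end, in which each bag meets the union of
the bags behind it inside one of these bags. -/
inductive RunningIntersection {V : Type*} (r : Finset V) : List (Finset V) → Prop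
  | root : RunningIntersection r [r]
  | cons {l : List (Finset V)} {b p : Finset V} : RunningIntersection r l → p ∈ l →
      (∀ x ∈ b, ∀ b' ∈ l, x ∈ b' → x ∈ p) → RunningIntersection r (b :: l)

namespace RunningIntersection

variable {V W : Type*} {r : Finset V} {l : List (Finset V)}

theorem root_mem (h : RunningIntersection r l) : r ∈ l := by
  induction h with
  | root => simp
  | cons _ _ _ ih => exact List.mem_cons_of_mem _ ih

/-- Two lists are joined when their common vertices lie in the root of one of them and in a bag of
the other. -/
theorem append {r' p : Finset V} {l' : List (Finset V)} (h : RunningIntersection r l)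
    (h' : RunningIntersection r' l') (hp : p ∈ l)
    (hl : ∀ b ∈ l, ∀ b' ∈ l', ∀ x ∈ b, x ∈ b' → x ∈ p ∧ x ∈ r') :
    RunningIntersection r (l' ++ l) := by
  induction h' with
  | root =>
    exact cons h hp fun x hx b hb hxb => (hl b hb r' (by simp) x hxb hx).1
  | @cons l' b q h' hq hb ih =>
    refine cons (ih fun b hb b' hb' => hl b hb b' (List.mem_cons_of_mem _ hb'))
      (List.mem_append_left _ hq) fun x hx b' hb' hxb' => ?_
    rcases List.mem_append.1 hb' with hb' | hb'
    · exact hb x hx b' hb' hxb'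
    -- A vertex of `b` that occurs in `l` lies in `r'`, which is already a bag of `l'`; the property
    -- of `l'` then puts it into `q`.
    · exact hb x hx r' h'.root_mem (hl b' hb' b (by simp) x hxb' hx).2

/-- The image under an injective map. -/
theorem map_injective [DecidableEq W] (h : RunningIntersection r l) {f : V → W}
    (hf : Function.Injective f) :
    RunningIntersection (r.image f) (l.map (Finset.image f)) := by
  induction h with
  | root => exact root
  | @cons l b p _ hp hb ih =>
    refine cons ih (List.mem_map_of_mem hp) fun x hx b' hb' hxb' => ?_
    obtain ⟨y, hy, rfl⟩ := Finset.mem_image.1 hx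
    obtain ⟨c, hc, rfl⟩ := List.mem_map.1 hb'
    exact Finset.mem_image_of_mem f (hb y hy c hc ((hf.mem_finset_image).1 hxb'))

/-- Operations on bags that act on membership pointwise preserve the property. -/
theorem map_of_mem_iff {F : Finset V → Finset W} (h : RunningIntersection r l)
    {P : W → Finset V → Prop} (hF : ∀ x b, x ∈ F b ↔ P x b)
    (hP : ∀ x b b' p, (∀ v ∈ b, v ∈ b' → v ∈ p) → P x b → P x b' → P x p) :
    RunningIntersection (F r) (l.map F) := by
  induction h with
  | root => exact root
  | @cons l b p _ hp hb ih =>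
    refine cons ih (List.mem_map_of_mem hp) fun x hx b' hb' hxb' => ?_
    obtain ⟨c, hc, rfl⟩ := List.mem_map.1 hb'
    rw [hF] at hx hxb' ⊢
    exact hP x b c p (fun v hv hv' => hb v hv c hc hv') hx hxb'

theorem union_right [DecidableEq V] (h : RunningIntersection r l) (N : Finset V) :
    RunningIntersection (r ∪ N) (l.map (· ∪ N)) :=
  h.map_of_mem_iff (P := fun x b => x ∈ b ∨ x ∈ N) (fun _ _ => Finset.mem_union)
    fun x b b' p hp hb hb' => by
      have := hp x
      tauto

/-- A set of vertices any two of which share a bag is contained in a bag. -/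
theorem exists_bag_of_clique (h : RunningIntersection r l) (K : Set V)
    (hK : ∀ x ∈ K, ∀ y ∈ K, ∃ b ∈ l, x ∈ b ∧ y ∈ b) : ∃ b ∈ l, ∀ x ∈ K, x ∈ b := by
  induction h with
  | root =>
    refine ⟨r, by simp, fun x hx => ?_⟩
    obtain ⟨b, hb, hx, -⟩ := hK x hx x hx
    rw [List.mem_singleton] at hb
    exact hb ▸ hx
  | @cons l b p _ hp hb ih =>
    -- This is the Helly property of subtrees. If all of `K` occurs behind `b`, a pair that shares
    -- `b` also shares `p`, and induction applies. Otherwise some vertex occurs only in `b`, and all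
    -- of `K` meets it there.
    by_cases hl : ∀ x ∈ K, ∃ b' ∈ l, x ∈ b'
    · obtain ⟨b', hb', h⟩ := ih fun x hx y hy => by
        obtain ⟨c, hc, hxc, hyc⟩ := hK x hx y hy
        rcases List.mem_cons.1 hc with rfl | hc
        · obtain ⟨d, hd, hxd⟩ := hl x hx
          obtain ⟨e, he, hye⟩ := hl y hy
          exact ⟨p, hp, hb x hxc d hd hxd, hb y hyc e he hye⟩
        · exact ⟨c, hc, hxc, hyc⟩
      exact ⟨b', List.mem_cons_of_mem _ hb', h⟩
    · push Not at hl
      obtain ⟨x, hx, hxl⟩ := hl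
      refine ⟨b, by simp, fun y hy => ?_⟩
      obtain ⟨c, hc, hxc, hyc⟩ := hK x hx y hy
      rcases List.mem_cons.1 hc with rfl | hc
      · exact hyc
      · exact absurd hxc (hxl c hc)

/-- Bags that contain a single vertex outside of all other bags can be added. -/
theorem exists_cover (h : RunningIntersection r l) (s : Finset V) :
    ∃ l', RunningIntersection r l' ∧ l ⊆ l' ∧ (∀ x ∈ s, ∃ b ∈ l', x ∈ b) ∧
      ∀ b ∈ l', b ∈ l ∨ b.card = 1 := by
  classical
  induction s using Finset.induction_on with
  | empty => exact ⟨l, h, fun _ => id, by simp, fun _ => Or.inl⟩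
  | insert x s _ ih =>
    obtain ⟨l', h', hl, hs, hc⟩ := ih
    by_cases hx : ∃ b ∈ l', x ∈ b
    · refine ⟨l', h', hl, fun y hy => ?_, hc⟩
      rcases Finset.mem_insert.1 hy with rfl | hy
      exacts [hx, hs y hy]
    · push Not at hx
      refine ⟨{x} :: l', cons h' h'.root_mem fun y hy b hb hyb => ?_,
        fun b hb => List.mem_cons_of_mem _ (hl hb), fun y hy => ?_, fun b hb => ?_⟩
      · rw [Finset.mem_singleton] at hy
        exact absurd (hy ▸ hyb) (hx b hb)
      · rcases Finset.mem_insert.1 hy with rfl | hy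
        · exact ⟨{y}, by simp, by simp⟩
        · obtain ⟨b, hb, hyb⟩ := hs y hy
          exact ⟨b, List.mem_cons_of_mem _ hb, hyb⟩
      · rcases List.mem_cons.1 hb with rfl | hb
        · simp
        · exact hc b hb

end RunningIntersection

/-! ### Adding a leaf to a tree -/

/-- The graph obtained by attaching the new vertex `none` to a vertex. -/
def addLeaf {N : Type*} (T : SimpleGraph N) (t : N) : SimpleGraph (Option N) where
  Adj x y := match x, y with
    | some a, some b => T.Adj a b
    | none, some b => b = t
    | some a, none => a = t
    | none, none => False
  symm := ⟨fun x y h => by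
    cases x <;> cases y <;> simp_all [SimpleGraph.adj_comm]⟩
  loopless := ⟨fun x h => by cases x <;> simp_all⟩

/-- A connected graph is a tree when it has one edge fewer than vertices, and attaching a leaf adds
one vertex and one edge. -/
theorem isTree_addLeaf {N : Type*} [Finite N] {T : SimpleGraph N} (hT : T.IsTree) (t : N) :
    (addLeaf T t).IsTree := by
  classical
  have := Fintype.ofFinite N
  let f : T ↪g addLeaf T t := ⟨Function.Embedding.some, Iff.rfl⟩
  have hreach : ∀ a b, (addLeaf T t).Reachable (some a) (some b) := fun a b =>
    (hT.1.preconnected a b).map f.toHom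
  have hnone : ∀ a, (addLeaf T t).Reachable none (some a) := fun a =>
    (SimpleGraph.Adj.reachable (show (addLeaf T t).Adj none (some t) from rfl)).trans
      (hreach t a)
  have hconn : (addLeaf T t).Connected := by
    refine (SimpleGraph.connected_iff _).2 ⟨fun x y => ?_, ⟨none⟩⟩
    cases x with
    | none => cases y with
      | none => exact .refl _
      | some b => exact hnone b
    | some a => cases y with
      | none => exact (hnone a).symm
      | some b => exact hreach a b
  refine SimpleGraph.isTree_iff_connected_and_card.2 ⟨hconn, ?_⟩
  have hcard := (SimpleGraph.isTree_iff_connected_and_card.1 hT).2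
  have hE : (addLeaf T t).edgeSet = insert s(none, some t) (Sym2.map some '' T.edgeSet) := by
    ext e
    induction e using Sym2.ind with
    | _ x y =>
      cases x with
      | none => cases y with
        | none =>
          simp only [SimpleGraph.mem_edgeSet, SimpleGraph.irrefl, false_iff, Set.mem_insert_iff,
            not_or]
          refine ⟨by simp, ?_⟩
          rintro ⟨e, -, he⟩
          induction e using Sym2.ind with | _ a b => simp at he
        | some b =>
          simp only [SimpleGraph.mem_edgeSet, Set.mem_insert_iff]
          constructor
          · intro h
            have : b = t := h
            left; rw [this]
          · rintro (h | ⟨e, -, he⟩)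
            · simp at h; exact h
            · induction e using Sym2.ind with | _ a b => simp at he
      | some a => cases y with
        | none =>
          simp only [SimpleGraph.mem_edgeSet, Set.mem_insert_iff]
          constructor
          · intro h
            have : a = t := h
            left; rw [this, Sym2.eq_swap]
          · rintro (h | ⟨e, -, he⟩)
            · simp at h; exact h
            · induction e using Sym2.ind with | _ a b => simp at he
        | some b =>
          simp only [SimpleGraph.mem_edgeSet, Set.mem_insert_iff]
          constructor
          · intro h
            exact Or.inr ⟨s(a, b), h, rfl⟩
          · rintro (h | ⟨e, he', he⟩)
            · simp at h
            · rw [← Sym2.map_mk, (Sym2.map.injective (Option.some_injective N)).eq_iff] at he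
              subst he
              exact he'
  rw [hE, Nat.card_coe_set_eq, Set.ncard_insert_of_notMem _ (Set.toFinite _),
    Set.ncard_image_of_injective _ (Sym2.map.injective (Option.some_injective N)),
    ← Nat.card_coe_set_eq, hcard, Finite.card_option]
  rintro ⟨e, -, he⟩
  induction e using Sym2.ind with | _ a b => simp at he

/-! ### Tree decompositions from lists of bags, and conversely -/

/-- Connectedness of the nodes of a vertex is expressed by chains in the whole node set, which can
be transported along maps of trees without subtypes. -/
theorem preconnected_induce_of_reflTransGen {N : Type*} {T : SimpleGraph N} {P : N → Prop}
    (h : ∀ s s', P s → P s' → Relation.ReflTransGen (fun a b => T.Adj a b ∧ P a ∧ P b) s s') :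
    (T.induce {t | P t}).Preconnected := by
  rintro ⟨s, hs⟩ ⟨s', hs'⟩
  have := h s s' hs hs'
  have key : ∀ hs'' : P s', (T.induce {t | P t}).Reachable ⟨s, hs⟩ ⟨s', hs''⟩ := by
    induction this with
    | refl => exact fun _ => .refl _
    | @tail b c _ hbc ih =>
      intro hc
      exact (ih hbc.2.1 hbc.2.1).trans
        (SimpleGraph.Adj.reachable (show (T.induce {t | P t}).Adj ⟨b, hbc.2.1⟩ ⟨c, hc⟩ from hbc.1))
  exact key hs'

theorem reflTransGen_of_preconnected_induce {N : Type*} {T : SimpleGraph N} {P : N → Prop}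
    (h : (T.induce {t | P t}).Preconnected) {s s' : N} (hs : P s) (hs' : P s') :
    Relation.ReflTransGen (fun a b => T.Adj a b ∧ P a ∧ P b) s s' := by
  have := (SimpleGraph.reachable_iff_reflTransGen _ _).1 (h ⟨s, hs⟩ ⟨s', hs'⟩)
  exact Relation.ReflTransGen.lift (p := fun a b => T.Adj a b ∧ P a ∧ P b)
    (fun x : {t | P t} => x.1) (fun a b hab => ⟨hab, a.2, b.2⟩) _ _ this

/-- Each new bag becomes a leaf attached to a node carrying its parent bag. The running intersection
condition says that a vertex of the new bag seen elsewhere is also in the parent, so its nodes stay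
connected. -/
theorem RunningIntersection.exists_tree {V : Type*} {r : Finset V} {l : List (Finset V)}
    (h : RunningIntersection r l) :
    ∃ (N : Type) (_ : Fintype N) (T : SimpleGraph N) (bag : N → Finset V), T.IsTree ∧
      (∀ t, bag t ∈ l) ∧ (∀ b ∈ l, ∃ t, bag t = b) ∧
      ∀ x s s', x ∈ bag s → x ∈ bag s' →
        Relation.ReflTransGen (fun a b => T.Adj a b ∧ x ∈ bag a ∧ x ∈ bag b) s s' := by
  induction h with
  | root =>
    exact ⟨Unit, inferInstance, ⊥, fun _ => r, SimpleGraph.IsTree.of_subsingleton, by simp,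
      by simp, fun x s s' _ _ => .refl⟩
  | @cons l b p _ hp hb ih =>
    obtain ⟨N, _, T, bag, hT, hbag, hl, hc⟩ := ih
    obtain ⟨t, rfl⟩ := hl p hp
    refine ⟨Option N, inferInstance, addLeaf T t, fun o => o.elim b bag, isTree_addLeaf hT t,
      ?_, ?_, ?_⟩
    · rintro (_ | s)
      · simp
      · exact List.mem_cons_of_mem _ (hbag s)
    · intro b' hb'
      rcases List.mem_cons.1 hb' with rfl | hb'
      · exact ⟨none, rfl⟩
      · obtain ⟨s, rfl⟩ := hl b' hb'
        exact ⟨some s, rfl⟩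
    · intro x
      have hsome : ∀ s s', x ∈ bag s → x ∈ bag s' → Relation.ReflTransGen (fun a c =>
          (addLeaf T t).Adj a c ∧ x ∈ a.elim b bag ∧ x ∈ c.elim b bag) (some s) (some s') :=
        fun s s' hs hs' => (hc x s s' hs hs').lift some fun _ _ h => h
      have hsymm : ∀ a c : Option N, ((addLeaf T t).Adj a c ∧ x ∈ a.elim b bag ∧ x ∈ c.elim b bag) →
          (addLeaf T t).Adj c a ∧ x ∈ c.elim b bag ∧ x ∈ a.elim b bag :=
        fun a c h => ⟨h.1.symm, h.2.2, h.2.1⟩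
      have hnone : ∀ s, x ∈ b → x ∈ bag s → Relation.ReflTransGen (fun a c =>
          (addLeaf T t).Adj a c ∧ x ∈ a.elim b bag ∧ x ∈ c.elim b bag) none (some s) :=
        fun s hx hs => by
          have ht := hb x hx _ (hbag s) hs
          exact .head (b := some t) ⟨(rfl : t = t), hx, ht⟩ (hsome t s ht hs)
      rintro (_ | s) (_ | s') hs hs'
      · exact .refl
      · exact hnone s' hs hs'
      · exact Relation.reflTransGen_swap.1
          (Relation.ReflTransGen.mono (fun a c => hsymm a c) _ _ (hnone s hs' hs))
      · exact hsome s s' hs hs'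

/-- A covering list of bags yields a tree decomposition. -/
theorem RunningIntersection.exists_treeDecomposition {V : Type u} {G : SimpleGraph V}
    {r : Finset V} {l : List (Finset V)} (h : RunningIntersection r l)
    (hV : ∀ x, ∃ b ∈ l, x ∈ b) (hG : ∀ x y, G.Adj x y → ∃ b ∈ l, x ∈ b ∧ y ∈ b) :
    ∃ D : TreeDecomposition G, ∀ t, D.bag t ∈ l := by
  obtain ⟨N, _, T, bag, hT, hbag, hl, hc⟩ := h.exists_tree
  refine ⟨⟨N, T, hT, bag, fun x => ?_, fun x y hxy => ?_⟩, hbag⟩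
  · obtain ⟨b, hb, hx⟩ := hV x
    obtain ⟨t, rfl⟩ := hl b hb
    exact (SimpleGraph.connected_iff _).2
      ⟨preconnected_induce_of_reflTransGen (hc x), ⟨⟨t, hx⟩⟩⟩
  · obtain ⟨b, hb, h⟩ := hG x y hxy
    obtain ⟨t, rfl⟩ := hl b hb
    exact ⟨t, h⟩

/-- Induction on the number of nodes: a leaf is removed, and its bag is put in front with the bag of
its neighbour as parent. -/
theorem exists_runningIntersection_of_tree {V : Type*} (n : ℕ) :
    ∀ (N : Type) [Fintype N] (T : SimpleGraph N) (bag : N → Finset V), Fintype.card N = n →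
      T.IsTree →
      (∀ x s s', x ∈ bag s → x ∈ bag s' →
        Relation.ReflTransGen (fun a b => T.Adj a b ∧ x ∈ bag a ∧ x ∈ bag b) s s') →
      ∃ r l, RunningIntersection r l ∧ (∀ b ∈ l, ∃ t, bag t = b) ∧ ∀ t, bag t ∈ l := by
  classical
  induction n with
  | zero =>
    intro N _ T bag hN hT
    have := hT.1.nonempty
    exact absurd hN Fintype.card_ne_zero
  | succ n ih =>
    intro N _ T bag hN hT hc
    rcases subsingleton_or_nontrivial N with hsub | hnt
    · obtain ⟨t⟩ := hT.1.nonempty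
      refine ⟨bag t, [bag t], .root, ?_, fun s => by simp [Subsingleton.elim s t]⟩
      intro b hb
      exact ⟨t, by simpa using (List.mem_singleton.1 hb).symm⟩
    · obtain ⟨t, ht⟩ := hT.exists_vert_degree_one_of_nontrivial
      obtain ⟨p, hp, hpu⟩ := SimpleGraph.degree_eq_one_iff_existsUnique_adj.1 ht
      have hcompl := hT.1.induce_compl_singleton_of_degree_eq_one ht
      have hT' : (T.induce {t}ᶜ).IsTree := ⟨hcompl, hT.2.induce _⟩
      have hcard : Fintype.card ({t}ᶜ : Set N) = n := by
        rw [Fintype.card_compl_set, hN]; simp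
      obtain ⟨r, l, hl, hbag, hmem⟩ := ih ({t}ᶜ : Set N) (T.induce {t}ᶜ) (fun s => bag s)
        hcard hT' (by
          rintro x ⟨s, hs⟩ ⟨s', hs'⟩ hxs hxs'
          have hpt : p ≠ t := hp.ne'
          -- Retracting the leaf `t` onto its only neighbour `p` turns a chain that may visit `t`
          -- into one in the smaller tree, steps between `t` and `p` becoming trivial.
          let ρ : N → ({t}ᶜ : Set N) := fun a => if h : a = t then ⟨p, hpt⟩ else ⟨a, h⟩
          have hρ : ∀ (a : N) (ha : a ≠ t), ρ a = ⟨a, ha⟩ := fun a ha => dif_neg ha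
          have hρt : ρ t = ⟨p, hpt⟩ := dif_pos rfl
          rw [← hρ s hs, ← hρ s' hs']
          refine Relation.ReflTransGen.lift' ρ (fun a b hab => ?_) s s' (hc x s s' hxs hxs')
          change Relation.ReflTransGen _ (ρ a) (ρ b)
          by_cases ha : a = t
          · subst ha
            rw [hpu b hab.1, hρt, hρ p hpt]
          · by_cases hb : b = t
            · subst hb
              rw [hpu a hab.1.symm, hρt, hρ p hpt]
            · rw [hρ a ha, hρ b hb]
              exact .single hab)
      refine ⟨r, bag t :: l, .cons hl (hmem ⟨p, hp.ne'⟩) fun x hx b' hb' hxb' => ?_, ?_, ?_⟩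
      · obtain ⟨s, rfl⟩ := hbag b' hb'
        -- A chain from the leaf to another node containing `x` starts by moving to `p`, so `x` lies
        -- in the bag of `p`.
        rcases Relation.ReflTransGen.cases_head (hc x t s hx hxb') with h | ⟨c, hc', -⟩
        · exact absurd h.symm s.2
        · exact hpu c hc'.1 ▸ hc'.2.2
      · intro b hb
        rcases List.mem_cons.1 hb with rfl | hb
        · exact ⟨t, rfl⟩
        · obtain ⟨s, rfl⟩ := hbag b hb
          exact ⟨s, rfl⟩
      · intro s
        by_cases hs : s = t
        · simp [hs]
        · exact List.mem_cons_of_mem _ (hmem ⟨s, hs⟩)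

/-- A tree decomposition yields a covering list of bags. -/
theorem TreeDecomposition.exists_runningIntersection {V : Type u} {G : SimpleGraph V}
    (D : TreeDecomposition G) :
    ∃ r l, RunningIntersection r l ∧ (∀ b ∈ l, (b.card : ℤ) ≤ D.width + 1) ∧
      (∀ x, ∃ b ∈ l, x ∈ b) ∧ ∀ x y, G.Adj x y → ∃ b ∈ l, x ∈ b ∧ y ∈ b := by
  let := D.nodeFintype
  obtain ⟨r, l, h, hbag, hmem⟩ := exists_runningIntersection_of_tree _ D.node D.tree D.bag rfl
    D.isTree fun x s s' hs hs' =>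
      reflTransGen_of_preconnected_induce (P := fun t => x ∈ D.bag t) (D.connected x).preconnected
        hs hs'
  refine ⟨r, l, h, fun b hb => ?_, fun x => ?_, fun x y hxy => ?_⟩
  · obtain ⟨t, rfl⟩ := hbag b hb
    have : (D.bag t).card ≤ Finset.univ.sup fun t => (D.bag t).card :=
      Finset.le_sup (f := fun t => (D.bag t).card) (Finset.mem_univ t)
    unfold TreeDecomposition.width
    simpa using this
  · obtain ⟨⟨t, ht⟩⟩ := (D.connected x).nonempty
    exact ⟨_, hmem t, ht⟩
  · obtain ⟨t, ht⟩ := D.edge x y hxy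
    exact ⟨_, hmem t, ht⟩

theorem TreeDecomposition.treewidth_le {V : Type u} {G : SimpleGraph V}
    (D : TreeDecomposition G) : treewidth G ≤ D.width :=
  csInf_le ⟨-1, by rintro _ ⟨D, rfl⟩; simp only [TreeDecomposition.width]; omega⟩ ⟨D, rfl⟩

/-- A list of bags that covers all edges bounds the treewidth. -/
theorem RunningIntersection.treewidth_le {V : Type u} [Finite V] {G : SimpleGraph V}
    {r : Finset V} {l : List (Finset V)} (h : RunningIntersection r l)
    (hG : ∀ x y, G.Adj x y → ∃ b ∈ l, x ∈ b ∧ y ∈ b) {k : ℕ} (hk : 1 ≤ k)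
    (hl : ∀ b ∈ l, b.card ≤ k) : treewidth G ≤ k := by
  have := Fintype.ofFinite V
  obtain ⟨l', h', hll', hs, hc⟩ := h.exists_cover Finset.univ
  obtain ⟨D, hD⟩ := h'.exists_treeDecomposition (G := G) (fun x => hs x (Finset.mem_univ x))
    fun x y hxy => by
      obtain ⟨b, hb, h⟩ := hG x y hxy
      exact ⟨b, hll' hb, h⟩
  refine D.treewidth_le.trans ?_
  -- Bags added to reach uncovered vertices are singletons, hence the role of `1 ≤ k`. The width is
  -- in fact at most `k - 1`.
  have : (@Finset.univ D.node D.nodeFintype).sup (fun t => (D.bag t).card) ≤ k := by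
    refine Finset.sup_le fun t _ => ?_
    rcases hc _ (hD t) with h | h
    · exact hl _ h
    · exact h.trans_le hk
  unfold TreeDecomposition.width
  omega

/-- Bags are pulled back along `f`, and injectivity keeps them small. This transfers the join tree
of a formula to a core embedded in its query. -/
theorem treewidth_le_of_injective {V W : Type*} [Finite V] {G : SimpleGraph V}
    {r : Finset W} {l : List (Finset W)} (h : RunningIntersection r l) {f : V → W}
    (hf : Function.Injective f)
    (hG : ∀ x y, G.Adj x y → ∃ b ∈ l, f x ∈ b ∧ f y ∈ b) {k : ℕ} (hk : 1 ≤ k)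
    (hl : ∀ b ∈ l, b.card ≤ k) : treewidth G ≤ k := by
  classical
  have h' := h.map_of_mem_iff (F := fun b => b.preimage f hf.injOn) (P := fun x b => f x ∈ b)
    (by simp) fun x b b' p hp hb hb' => hp _ hb hb'
  refine h'.treewidth_le (fun x y hxy => ?_) hk fun b hb => ?_
  · obtain ⟨b, hb, hx, hy⟩ := hG x y hxy
    exact ⟨_, List.mem_map_of_mem hb, by simpa using hx, by simpa using hy⟩
  · obtain ⟨c, hc, rfl⟩ := List.mem_map.1 hb
    rw [← Finset.card_image_of_injective _ hf]
    refine (Finset.card_le_card fun x hx => ?_).trans (hl c hc)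
    obtain ⟨y, hy, rfl⟩ := Finset.mem_image.1 hx
    simpa using hy

/-- On a finite graph, a bound on the treewidth yields a covering list of small bags. -/
theorem exists_runningIntersection_of_treewidth_le {V : Type u} [Finite V] {G : SimpleGraph V}
    {k : ℤ} (hk : treewidth G ≤ k) :
    ∃ r l, RunningIntersection r l ∧ (∀ b ∈ l, (b.card : ℤ) ≤ k + 1) ∧
      (∀ x, ∃ b ∈ l, x ∈ b) ∧ ∀ x y, G.Adj x y → ∃ b ∈ l, x ∈ b ∧ y ∈ b := by
  have := Fintype.ofFinite V
  -- The decomposition with a single bag shows that the infimum is over a nonempty set, so it is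
  -- attained and is not a default value of `sInf`.
  have hne : (Set.range fun D : TreeDecomposition G => D.width).Nonempty := by
    obtain ⟨D, -⟩ := (RunningIntersection.root (r := (Finset.univ : Finset V))
      ).exists_treeDecomposition (G := G) (by simp) (by simp)
    exact ⟨_, D, rfl⟩
  obtain ⟨D, hD⟩ := Int.csInf_mem hne
    ⟨-1, by rintro _ ⟨D, rfl⟩; simp only [TreeDecomposition.width]; omega⟩
  obtain ⟨r, l, h, hb, hV, hG⟩ := D.exists_runningIntersection
  refine ⟨r, l, h, fun b hbl => (hb b hbl).trans ?_, hV, hG⟩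
  have : D.width = treewidth G := hD
  omega

end SharpLogic

namespace SharpLogic

/-! ### Syntactic operations on primitive positive formulas -/

namespace PPFormula

variable {L : FirstOrder.Language.{0, v}}

theorem sat_congr {B : Type} [L.Structure B] (φ : PPFormula L) :
    ∀ {h h' : ℕ → B}, (∀ x ∈ φ.free, h x = h' x) → (φ.Sat h ↔ φ.Sat h') := by
  induction φ with
  | top => exact fun _ => Iff.rfl
  | rel R x =>
    intro h h' hh
    have : h ∘ x = h' ∘ x := funext fun i => hh _ (by simp [free])
    simp only [Sat, this]
  | and φ ψ ihφ ihψ =>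
    intro h h' hh
    exact and_congr (ihφ fun x hx => hh x (Finset.mem_union_left _ hx))
      (ihψ fun x hx => hh x (Finset.mem_union_right _ hx))
  | ex y φ ih =>
    intro h h' hh
    refine exists_congr fun b => ih fun x hx => ?_
    by_cases hxy : x = y
    · subst hxy; simp
    · simp [hxy, hh x (Finset.mem_erase.2 ⟨hxy, hx⟩)]

theorem card_free_le_width (φ : PPFormula L) : φ.free.card ≤ φ.width := by
  cases φ <;> simp [width, free]

/-- Existential quantification over the variables in a list. -/
def exList (s : List ℕ) (φ : PPFormula L) : PPFormula L := s.foldr ex φ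

theorem free_exList (s : List ℕ) (φ : PPFormula L) :
    (exList s φ).free = φ.free \ s.toFinset := by
  induction s with
  | nil => simp [exList]
  | cons x s ih =>
    have : exList (x :: s) φ = ex x (exList s φ) := rfl
    rw [this, free, ih]
    ext y
    simp
    tauto

theorem width_exList_le (s : List ℕ) (φ : PPFormula L) : (exList s φ).width ≤ φ.width := by
  induction s with
  | nil => exact le_rfl
  | cons x s ih =>
    refine max_le ?_ ih
    exact (Finset.card_le_card (Finset.erase_subset _ _)).trans
      ((card_free_le_width _).trans ih)

theorem sat_exList {B : Type} [L.Structure B] (s : List ℕ) (φ : PPFormula L) :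
    ∀ h : ℕ → B, (exList s φ).Sat h ↔ ∃ g : ℕ → B, (∀ x ∉ s, g x = h x) ∧ φ.Sat g := by
  induction s with
  | nil =>
    intro h
    refine ⟨fun hs => ⟨h, fun _ _ => rfl, hs⟩, ?_⟩
    rintro ⟨g, hg, hs⟩
    exact (sat_congr φ fun x _ => hg x (by simp)).1 hs
  | cons y s ih =>
    intro h
    change (∃ b : B, (exList s φ).Sat (Function.update h y b)) ↔ _
    constructor
    · rintro ⟨b, hb⟩
      obtain ⟨g, hg, hs⟩ := (ih _).1 hb
      refine ⟨g, fun x hx => ?_, hs⟩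
      rw [List.mem_cons, not_or] at hx
      rw [hg x hx.2, Function.update_of_ne hx.1]
    · rintro ⟨g, hg, hs⟩
      refine ⟨g y, (ih _).2 ⟨g, fun x hx => ?_, hs⟩⟩
      by_cases hxy : x = y
      · subst hxy; simp
      · rw [Function.update_of_ne hxy]
        exact hg x (by simp [hxy, hx])

/-- The conjunction of a list of formulas. -/
def conjList (ps : List (PPFormula L)) : PPFormula L := ps.foldr and top

theorem free_conjList_subset {ps : List (PPFormula L)} {b : Finset ℕ}
    (h : ∀ θ ∈ ps, θ.free ⊆ b) : (conjList ps).free ⊆ b := by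
  induction ps with
  | nil => simp [conjList, free]
  | cons θ ps ih =>
    exact Finset.union_subset (h θ (by simp)) (ih fun θ' h' => h θ' (List.mem_cons_of_mem _ h'))

theorem width_conjList_le {ps : List (PPFormula L)} {b : Finset ℕ} {k : ℕ} (hb : b.card ≤ k)
    (h : ∀ θ ∈ ps, θ.free ⊆ b) (hw : ∀ θ ∈ ps, θ.width ≤ k) : (conjList ps).width ≤ k := by
  induction ps with
  | nil => simp [conjList, width]
  | cons θ ps ih =>
    exact max_le ((Finset.card_le_card (free_conjList_subset h)).trans hb)
      (max_le (hw θ (by simp)) (ih (fun θ' h' => h θ' (List.mem_cons_of_mem _ h'))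
        fun θ' h' => hw θ' (List.mem_cons_of_mem _ h')))

theorem sat_conjList {B : Type} [L.Structure B] {ps : List (PPFormula L)} {h : ℕ → B} :
    (conjList ps).Sat h ↔ ∀ θ ∈ ps, θ.Sat h := by
  induction ps with
  | nil => simp [conjList, Sat]
  | cons θ ps ih =>
    change θ.Sat h ∧ (conjList ps).Sat h ↔ _
    simp [ih]

/-- Formulas whose free variables lie in the bags of a join tree have a conjunction that can be
evaluated along the tree, all variables outside of the root being quantified. -/
theorem exists_quantify_to_root {r : Finset ℕ} {l : List (Finset ℕ)}
    (h : RunningIntersection r l) {k : ℕ} (hk : ∀ b ∈ l, b.card ≤ k) :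
    ∀ ps : List (PPFormula L), (∀ θ ∈ ps, θ.width ≤ k) → (∀ θ ∈ ps, ∃ b ∈ l, θ.free ⊆ b) →
    ∃ Θ : PPFormula L, Θ.free ⊆ r ∧ Θ.width ≤ k ∧ ∀ (B : Type) [L.Structure B] (h : ℕ → B),
      Θ.Sat h ↔ ∃ g : ℕ → B, (∀ x ∈ r, g x = h x) ∧ ∀ θ ∈ ps, θ.Sat g := by
  classical
  induction h with
  | root =>
    intro ps hw hf
    have hf' : ∀ θ ∈ ps, θ.free ⊆ r := fun θ hθ => by simpa using hf θ hθ
    refine ⟨conjList ps, free_conjList_subset hf', width_conjList_le (hk r (by simp)) hf' hw,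
      fun B _ h => ?_⟩
    rw [sat_conjList]
    refine ⟨fun hs => ⟨h, fun _ _ => rfl, hs⟩, ?_⟩
    rintro ⟨g, hg, hs⟩ θ hθ
    exact (sat_congr θ fun x hx => hg x (hf' θ hθ hx)).1 (hs θ hθ)
  | @cons l b p hl hp hb ih =>
    intro ps hw hf
    -- The set `s` consists of the variables of `b` that occur in no other bag. Conjuncts that fit
    -- into a bag of `l` do not mention `s`, so quantifying `s` concerns only the others; these
    -- collapse to one conjunct `Θ₂` with free variables in `p`.
    let good : PPFormula L → Prop := fun θ => ∃ b ∈ l, θ.free ⊆ b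
    let s := b.filter fun x => ∀ b' ∈ l, x ∉ b'
    let Θ₂ := exList s.toList (conjList (ps.filter fun θ => ¬ good θ))
    have hfb : ∀ θ ∈ ps.filter (fun θ => ¬ good θ), θ.free ⊆ b := fun θ hθ => by
      simp only [decide_not, List.mem_filter, Bool.not_eq_eq_eq_not, Bool.not_true,
        decide_eq_false_iff_not] at hθ
      obtain ⟨c, hc, hcf⟩ := hf θ hθ.1
      rcases List.mem_cons.1 hc with rfl | hc
      · exact hcf
      · exact absurd ⟨c, hc, hcf⟩ hθ.2
    have hwidth : Θ₂.width ≤ k := (width_exList_le _ _).trans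
      (width_conjList_le (hk b (by simp)) hfb fun θ hθ => hw θ (List.mem_filter.1 hθ).1)
    have hfree : Θ₂.free ⊆ p := by
      intro x hx
      rw [free_exList, Finset.mem_sdiff] at hx
      have hxb := free_conjList_subset hfb hx.1
      have : ∃ b' ∈ l, x ∈ b' := by
        by_contra! hcon
        exact hx.2 (by simpa [s] using ⟨hxb, hcon⟩)
      obtain ⟨b', hb', hxb'⟩ := this
      exact hb x hxb b' hb' hxb'
    obtain ⟨Θ, hΘf, hΘw, hΘ⟩ := ih (fun b hb => hk b (List.mem_cons_of_mem _ hb))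
      (Θ₂ :: ps.filter fun θ => good θ)
      (by
        intro θ hθ
        rcases List.mem_cons.1 hθ with rfl | hθ
        · exact hwidth
        · exact hw θ (List.mem_filter.1 hθ).1)
      (by
        intro θ hθ
        rcases List.mem_cons.1 hθ with rfl | hθ
        · exact ⟨p, hp, hfree⟩
        · exact of_decide_eq_true (List.mem_filter.1 hθ).2)
    refine ⟨Θ, hΘf, hΘw, fun B _ h => (hΘ B h).trans ?_⟩
    constructor
    · rintro ⟨g, hg, hs⟩
      obtain ⟨g', hg', hs'⟩ := (sat_exList _ _ _).1 (hs Θ₂ (by simp))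
      -- Passing from `g` to `g'` changes values on `s` only, which no bag of `l` sees.
      have hgl : ∀ b' ∈ l, ∀ x ∈ b', g' x = g x := fun b' hb' x hx =>
        hg' x (by simp only [s, Finset.mem_toList, Finset.mem_filter]; exact fun h => h.2 b' hb' hx)
      refine ⟨g', fun x hx => (hgl r hl.root_mem x hx).trans (hg x hx), fun θ hθ => ?_⟩
      by_cases hgood : good θ
      · obtain ⟨b', hb', hθf⟩ := id hgood
        exact (sat_congr θ fun x hx => hgl b' hb' x (hθf hx)).2
          (hs θ (List.mem_cons_of_mem _ (List.mem_filter.2 ⟨hθ, decide_eq_true hgood⟩)))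
      · exact sat_conjList.1 hs' θ (List.mem_filter.2 ⟨hθ, decide_eq_true hgood⟩)
    · rintro ⟨g, hg, hs⟩
      refine ⟨g, hg, fun θ hθ => ?_⟩
      rcases List.mem_cons.1 hθ with rfl | hθ
      · exact (sat_exList _ _ _).2 ⟨g, fun _ _ => rfl,
          sat_conjList.2 fun θ hθ => hs θ (List.mem_filter.1 hθ).1⟩
      · exact hs θ (List.mem_filter.1 hθ).1

/-- Formulas whose free variables lie in the bags of a join tree have a conjunction in which all
variables outside of a given set are quantified. -/
theorem exists_quantify_to {r : Finset ℕ} {l : List (Finset ℕ)}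
    (h : RunningIntersection r l) {k n : ℕ} (hk : ∀ b ∈ l, b.card ≤ k) (N : Finset ℕ)
    (hN : N.card ≤ n) (ps : List (PPFormula L)) (hw : ∀ θ ∈ ps, θ.width ≤ k)
    (hf : ∀ θ ∈ ps, ∃ b ∈ l, θ.free ⊆ b) :
    ∃ Θ : PPFormula L, Θ.free ⊆ N ∧ Θ.width ≤ n + k ∧
      ∀ (B : Type) [L.Structure B] (h : ℕ → B),
      Θ.Sat h ↔ ∃ g : ℕ → B, (∀ x ∈ N, g x = h x) ∧ ∀ θ ∈ ps, θ.Sat g := by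
  -- Adding `N` to every bag costs at most `n` and places `N` in the root; the other root variables
  -- are quantified at the end.
  obtain ⟨Θ, hΘf, hΘw, hΘ⟩ := exists_quantify_to_root (h.union_right N) (k := n + k)
    (fun b hb => by
      obtain ⟨c, hc, rfl⟩ := List.mem_map.1 hb
      have := Finset.card_union_le c N
      have := hk c hc
      omega) ps (fun θ hθ => (hw θ hθ).trans (Nat.le_add_left _ _))
    (fun θ hθ => by
      obtain ⟨b, hb, hθb⟩ := hf θ hθ
      exact ⟨_, List.mem_map_of_mem hb, hθb.trans Finset.subset_union_left⟩)
  refine ⟨exList (r \ N).toList Θ, ?_, (width_exList_le _ _).trans hΘw, fun B _ h => ?_⟩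
  · intro x hx
    rw [free_exList, Finset.mem_sdiff] at hx
    have := hΘf hx.1
    simp only [Finset.toList_toFinset, Finset.mem_sdiff, Finset.mem_union] at hx this
    tauto
  · rw [sat_exList]
    constructor
    · rintro ⟨g, hg, hs⟩
      obtain ⟨g', hg', hs'⟩ := (hΘ B g).1 hs
      refine ⟨g', fun x hx => ?_, hs'⟩
      rw [hg' x (Finset.mem_union_right _ hx), hg x (by simp [hx])]
    · rintro ⟨g, hg, hs⟩
      refine ⟨fun x => if x ∈ r ∧ x ∉ N then g x else h x, fun x hx => ?_,
        (hΘ B _).2 ⟨g, fun x hx => ?_, hs⟩⟩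
      · rw [Finset.mem_toList, Finset.mem_sdiff] at hx
        simp [hx]
      · by_cases hxN : x ∈ N
        · simp [hxN, hg x hxN]
        · simp only [Finset.mem_union, hxN, or_false] at hx
          simp [hx, hxN]

end PPFormula

/-! ### Syntactic operations on `♯PP`-formulas -/

namespace SharpPP

variable {L : FirstOrder.Language.{0, v}}

theorem override_of_mem {B : Type} (h : ℕ → B) {V : Finset ℕ} (g : V → B) {x : ℕ} (hx : x ∈ V) :
    override h V g x = g ⟨x, hx⟩ := dif_pos hx

theorem override_of_notMem {B : Type} (h : ℕ → B) {V : Finset ℕ} (g : V → B) {x : ℕ}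
    (hx : x ∉ V) : override h V g x = h x := dif_neg hx

theorem eval_congr {B : Type} [Fintype B] [L.Structure B] (ψ : SharpPP L) (hψ : ψ.WellFormed) :
    ∀ {h h' : ℕ → B}, (∀ x ∈ ψ.free, h x = h' x) → ψ.eval h = ψ.eval h' := by
  induction ψ with
  | cast φ V =>
    intro h h' hh
    have := PPFormula.sat_congr φ fun x hx => hh x (hψ hx)
    by_cases hs : φ.Sat h' <;> simp [eval, this, hs]
  | proj V ψ ih =>
    intro h h' hh
    refine Finset.sum_congr rfl fun g _ => ih hψ.1 fun x hx => ?_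
    by_cases hxV : x ∈ V
    · rw [override_of_mem _ _ hxV, override_of_mem _ _ hxV]
    · rw [override_of_notMem _ _ hxV, override_of_notMem _ _ hxV]
      exact hh x (Finset.mem_sdiff.2 ⟨hx, hxV⟩)
  | expand V ψ ih =>
    intro h h' hh
    exact ih hψ.1 fun x hx => hh x (Finset.mem_union_right _ hx)
  | mul ψ θ ihψ ihθ =>
    intro h h' hh
    change ψ.eval h * θ.eval h = ψ.eval h' * θ.eval h'
    rw [ihψ hψ.1 hh, ihθ hψ.2.1 fun x hx => hh x (by rw [free, hψ.2.2.1]; exact hx)]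
  | add ψ θ ihψ ihθ =>
    intro h h' hh
    change ψ.eval h + θ.eval h = ψ.eval h' + θ.eval h'
    rw [ihψ hψ.1 hh, ihθ hψ.2.1 fun x hx => hh x (by rw [free, hψ.2.2]; exact hx)]
  | const n => exact fun _ => rfl

theorem sum_override_union {B : Type} [Fintype B] {s t : Finset ℕ} (hst : Disjoint s t)
    (h : ℕ → B) (F : (ℕ → B) → ℤ) :
    ∑ g : ↥(s ∪ t) → B, F (override h (s ∪ t) g) =
      ∑ g : t → B, ∑ g' : s → B, F (override (override h t g) s g') := by
  rw [← Fintype.sum_prod_type' (f := fun (g : t → B) (g' : s → B) =>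
    F (override (override h t g) s g'))]
  refine Fintype.sum_bijective (fun g : ↥(s ∪ t) → B =>
    ((fun x => g ⟨x, Finset.mem_union_right _ x.2⟩ : t → B),
      (fun x => g ⟨x, Finset.mem_union_left _ x.2⟩ : s → B))) ⟨?_, ?_⟩ _ _ ?_
  · intro g g' hgg
    rw [Prod.mk.injEq] at hgg
    funext ⟨x, hx⟩
    rcases Finset.mem_union.1 hx with h' | h'
    · exact congrFun hgg.2 ⟨x, h'⟩
    · exact congrFun hgg.1 ⟨x, h'⟩
  · rintro ⟨g, g'⟩
    refine ⟨fun x => if hx : x.1 ∈ s then g' ⟨x, hx⟩ else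
      g ⟨x, (Finset.mem_union.1 x.2).resolve_left hx⟩, ?_⟩
    refine Prod.ext (funext fun x => ?_) (funext fun x => ?_)
    · exact dif_neg (Finset.disjoint_right.1 hst x.2)
    · exact dif_pos x.2
  · intro g
    congr 1
    funext x
    by_cases hs : x ∈ s
    · rw [override_of_mem _ _ (Finset.mem_union_left _ hs), override_of_mem _ _ hs]
    · rw [override_of_notMem _ _ hs]
      by_cases ht : x ∈ t
      · rw [override_of_mem _ _ (Finset.mem_union_right _ ht), override_of_mem _ _ ht]
      · rw [override_of_notMem _ _ (by simp [hs, ht]), override_of_notMem _ _ ht]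

/-- The product of a list of formulas, each expanded to the variables in `b`. -/
def prodAt (b : Finset ℕ) (qs : List (SharpPP L)) : SharpPP L :=
  -- The empty product is `C(⊤, b)` and not the constant 1, because both factors of a product must
  -- have the same free variables.
  qs.foldr (fun q acc => mul (expand (b \ q.free) q) acc) (cast .top b)

theorem prodAt_cons (b : Finset ℕ) (q : SharpPP L) (qs : List (SharpPP L)) :
    prodAt b (q :: qs) = mul (expand (b \ q.free) q) (prodAt b qs) := rfl

theorem free_prodAt {b : Finset ℕ} {qs : List (SharpPP L)} (h : ∀ q ∈ qs, q.free ⊆ b) :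
    (prodAt b qs).free = b := by
  cases qs with
  | nil => rfl
  | cons q qs => exact Finset.sdiff_union_of_subset (h q (by simp))

theorem mem_closed_prodAt {b : Finset ℕ} {qs : List (SharpPP L)} {x : ℕ} :
    x ∈ (prodAt b qs).closed ↔ ∃ q ∈ qs, x ∈ q.closed := by
  induction qs with
  | nil => simp [prodAt, closed]
  | cons q qs ih => simp [prodAt_cons, closed, ih]

theorem wellFormed_prodAt {b : Finset ℕ} {qs : List (SharpPP L)} (hf : ∀ q ∈ qs, q.free ⊆ b)
    (hw : ∀ q ∈ qs, q.WellFormed) (hd : ∀ q ∈ qs, Disjoint b q.closed)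
    (hp : qs.Pairwise fun q q' => Disjoint q.closed q'.closed) :
    (prodAt b qs).WellFormed := by
  induction qs with
  | nil => simp [prodAt, WellFormed, PPFormula.free]
  | cons q qs ih =>
    rw [List.pairwise_cons] at hp
    have hf' : ∀ q ∈ qs, q.free ⊆ b := fun q h => hf q (List.mem_cons_of_mem _ h)
    refine ⟨⟨hw q (by simp), ?_⟩, ih hf' (fun q h => hw q (List.mem_cons_of_mem _ h))
      (fun q h => hd q (List.mem_cons_of_mem _ h)) hp.2, ?_, ?_⟩
    · exact Finset.disjoint_union_right.2 ⟨Finset.sdiff_disjoint,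
        (hd q (by simp)).mono_left Finset.sdiff_subset⟩
    · change b \ q.free ∪ q.free = (prodAt b qs).free
      rw [free_prodAt hf']
      exact Finset.sdiff_union_of_subset (hf q (by simp))
    · change Disjoint q.closed _
      rw [Finset.disjoint_right]
      intro x hx
      obtain ⟨q', hq', hx'⟩ := mem_closed_prodAt.1 hx
      exact Finset.disjoint_right.1 (hp.1 q' hq') hx'

theorem eval_prodAt {B : Type} [Fintype B] [L.Structure B] (b : Finset ℕ) (qs : List (SharpPP L))
    (h : ℕ → B) : (prodAt b qs).eval h = (qs.map fun q => q.eval h).prod := by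
  induction qs with
  | nil => simp [prodAt, eval, PPFormula.Sat]
  | cons q qs ih => simp [prodAt_cons, eval, ih]

theorem sharpWidth_prodAt_le {b : Finset ℕ} {qs : List (SharpPP L)} {k : ℕ} (hb : b.card ≤ k)
    (hf : ∀ q ∈ qs, q.free ⊆ b) (hw : ∀ q ∈ qs, q.sharpWidth ≤ k) :
    (prodAt b qs).sharpWidth ≤ k := by
  induction qs with
  | nil => simpa [prodAt, sharpWidth, free]
  | cons q qs ih =>
    have : (b \ q.free) ∪ q.free = b := Finset.sdiff_union_of_subset (hf q (by simp))
    simp only [prodAt_cons, sharpWidth, free, this]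
    exact max_le hb (max_le (max_le hb (hw q (by simp))) (ih
      (fun q h => hf q (List.mem_cons_of_mem _ h)) fun q h => hw q (List.mem_cons_of_mem _ h)))

theorem width_prodAt_le {b : Finset ℕ} {qs : List (SharpPP L)} {k : ℕ} (hb : b.card ≤ k)
    (hf : ∀ q ∈ qs, q.free ⊆ b) (hw : ∀ q ∈ qs, q.width ≤ k) :
    (prodAt b qs).width ≤ k := by
  induction qs with
  | nil => simpa [prodAt, width, free, PPFormula.width]
  | cons q qs ih =>
    have : (b \ q.free) ∪ q.free = b := Finset.sdiff_union_of_subset (hf q (by simp))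
    simp only [prodAt_cons, width, free, this]
    exact max_le hb (max_le (max_le hb (hw q (by simp))) (ih
      (fun q h => hf q (List.mem_cons_of_mem _ h)) fun q h => hw q (List.mem_cons_of_mem _ h)))

/-- The union of a list of bags. -/
def bagUnion (l : List (Finset ℕ)) : Finset ℕ := l.foldr (· ∪ ·) ∅

theorem mem_bagUnion {l : List (Finset ℕ)} {x : ℕ} : x ∈ bagUnion l ↔ ∃ b ∈ l, x ∈ b := by
  induction l with
  | nil => simp [bagUnion]
  | cons b l ih =>
    change x ∈ b ∪ bagUnion l ↔ _
    simp [ih]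

theorem prod_map_filter {α : Type*} (qs : List α) (P : α → Prop) [DecidablePred P] (f : α → ℤ) :
    ((qs.filter fun q => ¬ P q).map f).prod * ((qs.filter fun q => P q).map f).prod =
      (qs.map f).prod := by
  induction qs with
  | nil => simp
  | cons q qs ih =>
    rw [List.map_cons, List.prod_cons, ← ih]
    by_cases hq : P q <;> simp [hq] <;> ring

theorem disjoint_closed_of_pairwise {qs : List (SharpPP L)}
    (hp : qs.Pairwise fun q q' => Disjoint q.closed q'.closed) (P : SharpPP L → Prop)
    [DecidablePred P] {q q' : SharpPP L} (hq : q ∈ qs) (hq' : q' ∈ qs) (hPq : P q)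
    (hPq' : ¬ P q') : Disjoint q.closed q'.closed := by
  have : Std.Symm fun q q' : SharpPP L => Disjoint q.closed q'.closed := ⟨fun _ _ h => h.symm⟩
  exact hp.forall hq hq' (by rintro rfl; exact hPq' hPq)

/-- Formulas whose free variables lie in the bags of a join tree have a product that can be summed
along the tree. -/
theorem exists_sum_along {r : Finset ℕ} {l : List (Finset ℕ)}
    (h : RunningIntersection r l) {k m : ℕ} (hkm : k ≤ m) (hk : ∀ b ∈ l, b.card ≤ k) :
    ∀ qs : List (SharpPP L), (∀ q ∈ qs, q.WellFormed) → (∀ q ∈ qs, ∃ b ∈ l, q.free ⊆ b) →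
      (∀ q ∈ qs, ∀ b ∈ l, Disjoint b q.closed) →
      (qs.Pairwise fun q q' => Disjoint q.closed q'.closed) →
      (∀ q ∈ qs, q.sharpWidth ≤ k) → (∀ q ∈ qs, q.width ≤ m) →
    ∃ Ψ : SharpPP L, Ψ.WellFormed ∧ Ψ.free = ∅ ∧ Ψ.sharpWidth ≤ k ∧ Ψ.width ≤ m ∧
      ∀ (B : Type) [Fintype B] [L.Structure B] (h : ℕ → B), Ψ.eval h =
        ∑ g : bagUnion l → B, (qs.map fun q => q.eval (override h (bagUnion l) g)).prod := by
  classical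
  induction h with
  | root =>
    intro qs hw hf hd hp hs ht
    have hf' : ∀ q ∈ qs, q.free ⊆ r := fun q hq => by simpa using hf q hq
    have hd' : ∀ q ∈ qs, Disjoint r q.closed := fun q hq => hd q hq r (by simp)
    have hr := hk r (by simp)
    refine ⟨proj r (prodAt r qs), ⟨wellFormed_prodAt hf' hw hd' hp, ?_⟩, ?_, ?_, ?_, ?_⟩
    · rw [Finset.disjoint_right]
      intro x hx
      obtain ⟨q, hq, hx⟩ := mem_closed_prodAt.1 hx
      exact Finset.disjoint_right.1 (hd' q hq) hx
    · simp [free, free_prodAt hf']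
    · exact max_le (by simp [free, free_prodAt hf']) (sharpWidth_prodAt_le hr hf' hs)
    · exact max_le (by simp [free, free_prodAt hf']) (width_prodAt_le (hr.trans hkm) hf' ht)
    · intro B _ _ h
      have : bagUnion [r] = r := by simp [bagUnion]
      rw [this]
      simp only [eval, eval_prodAt]
  | @cons l b p hl hpl hb ih =>
    intro qs hw hf hd hp hs ht
    -- Variable elimination for sums: only factors that fit into no bag of `l` can depend on `s`,
    -- the variables new in `b`. By distributivity the sum over `s` moves onto their product, giving
    -- one factor `Q` whose free variables lie in `p`.
    let good : SharpPP L → Prop := fun q => ∃ b ∈ l, q.free ⊆ b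
    let s := b \ bagUnion l
    let qs₂ := qs.filter fun q => ¬ good q
    have hbk := hk b (by simp)
    have hsub : ∀ {q}, q ∈ qs₂ → q ∈ qs := fun hq => (List.mem_filter.1 hq).1
    have hbad : ∀ {q}, q ∈ qs₂ → ¬ good q := fun hq => of_decide_eq_true (List.mem_filter.1 hq).2
    have hsub' : ∀ {q}, q ∈ qs.filter (fun q => good q) → q ∈ qs :=
      fun hq => (List.mem_filter.1 hq).1
    have hgood : ∀ {q}, q ∈ qs.filter (fun q => good q) → good q :=
      fun hq => of_decide_eq_true (List.mem_filter.1 hq).2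
    have hfb : ∀ q ∈ qs₂, q.free ⊆ b := fun q hq => by
      obtain ⟨c, hc, hcf⟩ := hf q (hsub hq)
      rcases List.mem_cons.1 hc with rfl | hc
      · exact hcf
      · exact absurd ⟨c, hc, hcf⟩ (hbad hq)
    let Q := proj s (prodAt b qs₂)
    have hQclosed : ∀ {x}, x ∈ Q.closed ↔ x ∈ s ∨ ∃ q ∈ qs₂, x ∈ q.closed := fun {x} => by
      simp only [Q, closed, Finset.mem_union, mem_closed_prodAt]
    have hQfree : Q.free ⊆ p := by
      intro x hx
      simp only [Q, free, free_prodAt hfb, s, Finset.mem_sdiff, mem_bagUnion, not_and, not_not]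
        at hx
      obtain ⟨b', hb', hxb'⟩ := hx.2 hx.1
      exact hb x hx.1 b' hb' hxb'
    have hQcard : Q.free.card ≤ k :=
      (Finset.card_le_card hQfree).trans (hk p (List.mem_cons_of_mem _ hpl))
    have hQw : Q.WellFormed := by
      refine ⟨wellFormed_prodAt hfb (fun q hq => hw q (hsub hq))
        (fun q hq => hd q (hsub hq) b (by simp)) (hp.filter _), ?_⟩
      rw [Finset.disjoint_right]
      intro x hx hxs
      obtain ⟨q, hq, hx⟩ := mem_closed_prodAt.1 hx
      exact Finset.disjoint_left.1 (hd q (hsub hq) b (by simp)) (Finset.mem_sdiff.1 hxs).1 hx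
    obtain ⟨Ψ, hΨw, hΨf, hΨs, hΨt, hΨ⟩ := ih (fun b hb => hk b (List.mem_cons_of_mem _ hb))
      (Q :: qs.filter fun q => good q)
      (by
        intro q hq
        rcases List.mem_cons.1 hq with rfl | hq
        exacts [hQw, hw q (hsub' hq)])
      (by
        intro q hq
        rcases List.mem_cons.1 hq with rfl | hq
        exacts [⟨p, hpl, hQfree⟩, hgood hq])
      (by
        intro q hq b' hb'
        rcases List.mem_cons.1 hq with rfl | hq
        · rw [Finset.disjoint_right]
          intro x hx hxb'
          rcases hQclosed.1 hx with hx | ⟨q, hq, hx⟩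
          -- The variables closed by `Q` are new in `b`, so they never reappear in the bags that
          -- remain.
          · exact (Finset.mem_sdiff.1 hx).2 (mem_bagUnion.2 ⟨b', hb', hxb'⟩)
          · exact Finset.disjoint_left.1 (hd q (hsub hq) b' (List.mem_cons_of_mem _ hb')) hxb' hx
        · exact hd q (hsub' hq) b' (List.mem_cons_of_mem _ hb'))
      (by
        refine List.pairwise_cons.2 ⟨fun q hq => ?_, hp.filter _⟩
        rw [Finset.disjoint_left]
        intro x hx hxq
        rcases hQclosed.1 hx with hx | ⟨q', hq', hx⟩
        · exact Finset.disjoint_left.1 (hd q (hsub' hq) b (by simp)) (Finset.mem_sdiff.1 hx).1 hxq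
        · exact Finset.disjoint_left.1 (disjoint_closed_of_pairwise hp good (hsub' hq) (hsub hq')
            (hgood hq) (hbad hq')) hxq hx)
      (by
        intro q hq
        rcases List.mem_cons.1 hq with rfl | hq
        · exact max_le hQcard (sharpWidth_prodAt_le hbk hfb fun q hq => hs q (hsub hq))
        · exact hs q (hsub' hq))
      (by
        intro q hq
        rcases List.mem_cons.1 hq with rfl | hq
        · exact max_le (hQcard.trans hkm)
            (width_prodAt_le (hbk.trans hkm) hfb fun q hq => ht q (hsub hq))
        · exact ht q (hsub' hq))
    refine ⟨Ψ, hΨw, hΨf, hΨs, hΨt, fun B _ _ h => (hΨ B h).trans ?_⟩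
    have hU : bagUnion (b :: l) = s ∪ bagUnion l := by
      change b ∪ bagUnion l = _
      rw [Finset.sdiff_union_self_eq_union]
    rw [hU, sum_override_union Finset.sdiff_disjoint h
      fun g => (qs.map fun q => q.eval g).prod]
    refine Finset.sum_congr rfl fun g _ => ?_
    have hQeval : ∀ h' : ℕ → B, Q.eval h' =
        ∑ g' : s → B, (qs₂.map fun q => q.eval (override h' s g')).prod := fun h' => by
      simp only [Q, eval, eval_prodAt]
    rw [List.map_cons, List.prod_cons, hQeval, Finset.sum_mul]
    refine Finset.sum_congr rfl fun g' _ => ?_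
    rw [← prod_map_filter qs good]
    congr 2
    refine List.map_congr_left fun q hq => eval_congr q (hw q (hsub' hq)) fun x hx => ?_
    obtain ⟨b', hb', hqb'⟩ := hgood hq
    rw [override_of_notMem _ g']
    exact fun hxs => (Finset.mem_sdiff.1 hxs).2 (mem_bagUnion.2 ⟨b', hb', hqb' hx⟩)

open Classical in
theorem prod_map_ite {α : Type*} (qs : List α) (P : α → Prop) :
    (qs.map fun q => if P q then (1 : ℤ) else 0).prod = if ∀ q ∈ qs, P q then 1 else 0 := by
  induction qs with
  | nil => simp
  | cons q qs ih =>
    rw [List.map_cons, List.prod_cons, ih]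
    by_cases hq : P q <;> simp [hq]

end SharpPP

end SharpLogic

namespace SharpLogic

/-! ### From tree decompositions to representations -/

namespace PrenexPP

variable {L : FirstOrder.Language.{0, v}}

/-- An atom as a formula. -/
def _root_.SharpLogic.Atom.toPP (a : Atom L) : PPFormula L := .rel a.rel a.args

theorem _root_.SharpLogic.Atom.mem_free_toPP {a : Atom L} {x : ℕ} :
    x ∈ a.toPP.free ↔ ∃ i, a.args i = x := by
  simp [Atom.toPP, PPFormula.free]

open Classical in
/-- The atoms in which a variable of a component of the quantified variables appears. -/
noncomputable def componentAtoms (φ : PrenexPP L)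
    (V : (φ.graph.induce φ.quantified).ConnectedComponent) : Finset (Atom L) :=
  φ.atoms.filter fun a => ∃ i, ∃ y ∈ V.supp, ((y : φ.dom) : ℕ) = a.args i

open Classical in
/-- The liberal variables of an `∃`-component. -/
noncomputable def boundary (φ : PrenexPP L)
    (V : (φ.graph.induce φ.quantified).ConnectedComponent) : Finset ℕ :=
  φ.lib.filter fun s => ∃ hs : s ∈ φ.lib, φ.ofLib ⟨s, hs⟩ ∈ φ.existsComponent V

/-- Satisfaction splits into the conditions on atoms without quantified variables, and one
condition for each component of the quantified variables. -/
theorem mem_answers_iff (φ : PrenexPP L) {B : Type} [L.Structure B] (f : φ.lib → B) (h : ℕ → B) :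
    f ∈ φ.answers B ↔
      (∀ a ∈ φ.atoms, (∀ i, a.args i ∈ φ.lib) → a.toPP.Sat (SharpPP.override h φ.lib f)) ∧
      ∀ V, ∃ g : ℕ → B, (∀ x ∈ φ.boundary V, g x = SharpPP.override h φ.lib f x) ∧
        ∀ a ∈ φ.componentAtoms V, a.toPP.Sat g := by
  classical
  constructor
  · rintro ⟨g, hg, hs⟩
    let G : ℕ → B := SharpPP.override h φ.dom g
    have hG : ∀ x ∈ φ.lib, G x = SharpPP.override h φ.lib f x := fun x hx => by
      rw [SharpPP.override_of_mem _ _ hx]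
      exact (SharpPP.override_of_mem _ _ (φ.lib_subset hx)).trans (hg ⟨x, hx⟩)
    have hsat : ∀ a ∈ φ.atoms, a.toPP.Sat G := fun a ha => by
      have : G ∘ a.args = fun i => g ⟨a.args i, φ.args_mem a ha i⟩ :=
        funext fun i => SharpPP.override_of_mem _ _ (φ.args_mem a ha i)
      change FirstOrder.Language.Structure.RelMap a.rel (G ∘ a.args)
      rw [this]
      exact hs a ha
    refine ⟨fun a ha hlib => ?_, fun V => ⟨G, fun x hx => hG x (Finset.mem_filter.1 hx).1,
      fun a ha => hsat a (Finset.mem_filter.1 ha).1⟩⟩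
    refine (PPFormula.sat_congr _ fun x hx => ?_).1 (hsat a ha)
    obtain ⟨i, rfl⟩ := Atom.mem_free_toPP.1 hx
    exact hG _ (hlib i)
  · rintro ⟨hlib, hV⟩
    choose G hG hs using hV
    -- The local witnesses are glued: each quantified variable takes its value from the witness of
    -- its own component.
    refine ⟨fun x => if hx : (x : ℕ) ∈ φ.lib then f ⟨x, hx⟩ else
      G ((φ.graph.induce φ.quantified).connectedComponentMk ⟨x, hx⟩) x,
      fun s => dif_pos s.2, fun a ha => ?_⟩
    by_cases hall : ∀ i, a.args i ∈ φ.lib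
    · have := hlib a ha hall
      change FirstOrder.Language.Structure.RelMap a.rel _ at this
      convert this using 1
      funext i
      rw [Function.comp_apply, SharpPP.override_of_mem _ _ (hall i)]
      exact dif_pos (hall i)
    -- One quantified variable of the atom fixes the component `V`: the other quantified variables
    -- of the atom are equal or adjacent to it, and the liberal ones are in the boundary of `V`.
    · push Not at hall
      obtain ⟨i, hi⟩ := hall
      let y : φ.quantified := ⟨⟨a.args i, φ.args_mem a ha i⟩, hi⟩
      let V := (φ.graph.induce φ.quantified).connectedComponentMk y
      have haV : a ∈ φ.componentAtoms V := Finset.mem_filter.2 ⟨ha, i, y, rfl, rfl⟩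
      have := hs V a haV
      change FirstOrder.Language.Structure.RelMap a.rel _ at this
      convert this using 1
      funext j
      rw [Function.comp_apply]
      have hadj : a.args j ≠ a.args i → φ.graph.Adj ⟨a.args j, φ.args_mem a ha j⟩ y := fun hne =>
        ⟨fun h => hne (congrArg Subtype.val h), a, ha, ⟨j, rfl⟩, ⟨i, rfl⟩⟩
      by_cases hj : a.args j ∈ φ.lib
      · have hne : a.args j ≠ a.args i := fun h => hi (h ▸ hj)
        have hb : a.args j ∈ φ.boundary V :=
          Finset.mem_filter.2 ⟨hj, hj, Or.inr ⟨hj, y, rfl, hadj hne⟩⟩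
        rw [hG V _ hb, SharpPP.override_of_mem _ _ hj]
        exact dif_pos hj
      · refine (dif_neg hj).trans (congrArg (fun V => G V (a.args j)) ?_)
        by_cases hne : a.args j = a.args i
        · simp only [hne, V, y]
        · exact SimpleGraph.ConnectedComponent.sound
            (SimpleGraph.Adj.reachable (show (φ.graph.induce φ.quantified).Adj _ _ from hadj hne))

/-- The liberal variables of an atom, and the boundary of a component, are cliques of the
contraction, so each condition of `mem_answers_iff` fits into a bag of `l`, and the count is summed
along `l`. The conditions of the components are eliminated along `l'` with a boundary of size at
most `k` added to every bag, whence `k + m`. The `♯`-width does not depend on `m`. -/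
theorem exists_represents (φ : PrenexPP L) {k m : ℕ}
    {r : Finset φ.lib} {l : List (Finset φ.lib)} (hl : RunningIntersection r l)
    (hk : ∀ b ∈ l, b.card ≤ k) (hcov : ∀ x, ∃ b ∈ l, x ∈ b)
    (hadj : ∀ x y, φ.contract.Adj x y → ∃ b ∈ l, x ∈ b ∧ y ∈ b)
    {r' : Finset φ.dom} {l' : List (Finset φ.dom)} (hl' : RunningIntersection r' l')
    (hm : ∀ b ∈ l', b.card ≤ m) (hcov' : ∀ x, ∃ b ∈ l', x ∈ b)
    (hadj' : ∀ x y, φ.graph.Adj x y → ∃ b ∈ l', x ∈ b ∧ y ∈ b) :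
    ∃ ψ : SharpPP L, ψ.Represents φ ∧ ψ.sharpWidth ≤ k ∧ ψ.width ≤ k + m := by
  classical
  let ℓ := l.map (Finset.image (Subtype.val : φ.lib → ℕ))
  let ℓ' := l'.map (Finset.image (Subtype.val : φ.dom → ℕ))
  have hℓ : RunningIntersection _ ℓ := hl.map_injective Subtype.val_injective
  have hℓ' : RunningIntersection _ ℓ' := hl'.map_injective Subtype.val_injective
  have hℓk : ∀ b ∈ ℓ, b.card ≤ k := fun b hb => by
    obtain ⟨c, hc, rfl⟩ := List.mem_map.1 hb
    exact Finset.card_image_le.trans (hk c hc)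
  have hℓm : ∀ b ∈ ℓ', b.card ≤ m := fun b hb => by
    obtain ⟨c, hc, rfl⟩ := List.mem_map.1 hb
    exact Finset.card_image_le.trans (hm c hc)
  have hU : SharpPP.bagUnion ℓ = φ.lib := by
    ext x
    rw [SharpPP.mem_bagUnion]
    constructor
    · rintro ⟨b, hb, hx⟩
      obtain ⟨c, hc, rfl⟩ := List.mem_map.1 hb
      obtain ⟨y, -, rfl⟩ := Finset.mem_image.1 hx
      exact y.2
    · intro hx
      obtain ⟨b, hb, hxb⟩ := hcov ⟨x, hx⟩
      exact ⟨_, List.mem_map_of_mem hb, Finset.mem_image_of_mem _ hxb⟩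
  have hclique : ∀ K : Set ℕ, (hKlib : K ⊆ φ.lib) →
      (∀ x (hx : x ∈ K) y (hy : y ∈ K), x ≠ y →
        φ.contract.Adj ⟨x, hKlib hx⟩ ⟨y, hKlib hy⟩) → ∃ b ∈ ℓ, K ⊆ b := by
    intro K hKlib hK
    refine hℓ.exists_bag_of_clique K fun x hx y hy => ?_
    by_cases hxy : x = y
    · subst hxy
      obtain ⟨b, hb, hxb⟩ := hcov ⟨x, hKlib hx⟩
      have := Finset.mem_image_of_mem Subtype.val hxb
      exact ⟨_, List.mem_map_of_mem hb, this, this⟩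
    · obtain ⟨b, hb, hxb, hyb⟩ := hadj _ _ (hK x hx y hy hxy)
      exact ⟨_, List.mem_map_of_mem hb, Finset.mem_image_of_mem Subtype.val hxb,
        Finset.mem_image_of_mem Subtype.val hyb⟩
  have hatom : ∀ a ∈ φ.atoms, ∃ b ∈ ℓ', a.toPP.free ⊆ b := by
    intro a ha
    refine hℓ'.exists_bag_of_clique (a.toPP.free : Set ℕ) fun x hx y hy => ?_
    obtain ⟨i, rfl⟩ := Atom.mem_free_toPP.1 hx
    obtain ⟨j, rfl⟩ := Atom.mem_free_toPP.1 hy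
    by_cases hxy : a.args i = a.args j
    · obtain ⟨b, hb, hxb⟩ := hcov' ⟨a.args i, φ.args_mem a ha i⟩
      have := Finset.mem_image_of_mem Subtype.val hxb
      exact ⟨_, List.mem_map_of_mem hb, this, hxy ▸ this⟩
    · obtain ⟨b, hb, hxb, hyb⟩ := hadj' ⟨a.args i, φ.args_mem a ha i⟩
        ⟨a.args j, φ.args_mem a ha j⟩
        ⟨fun h => hxy (congrArg Subtype.val h), a, ha, ⟨i, rfl⟩, ⟨j, rfl⟩⟩
      exact ⟨_, List.mem_map_of_mem hb, Finset.mem_image_of_mem Subtype.val hxb,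
        Finset.mem_image_of_mem Subtype.val hyb⟩
  have hatomw : ∀ a ∈ φ.atoms, a.toPP.width ≤ m := fun a ha => by
    obtain ⟨b, hb, hab⟩ := hatom a ha
    exact (Finset.card_le_card hab).trans (hℓm b hb)
  have hbound : ∀ V, ∃ b ∈ ℓ, φ.boundary V ⊆ b := by
    intro V
    have hKlib : ((φ.boundary V : Finset ℕ) : Set ℕ) ⊆ φ.lib := fun x hx =>
      (Finset.mem_filter.1 hx).1
    refine hclique _ hKlib fun x hx y hy hxy => ?_
    obtain ⟨-, hx', hxV⟩ := Finset.mem_filter.1 hx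
    obtain ⟨-, hy', hyV⟩ := Finset.mem_filter.1 hy
    exact ⟨fun h => hxy (congrArg Subtype.val h), Or.inr ⟨V, hxV, hyV⟩⟩
  have hboundk : ∀ V, (φ.boundary V).card ≤ k := fun V => by
    obtain ⟨b, hb, hbV⟩ := hbound V
    exact (Finset.card_le_card hbV).trans (hℓk b hb)
  have hpiece : ∀ V, ∃ Θ : PPFormula L, Θ.free ⊆ φ.boundary V ∧ Θ.width ≤ k + m ∧
      ∀ (B : Type) [L.Structure B] (h : ℕ → B),
      Θ.Sat h ↔ ∃ g : ℕ → B, (∀ x ∈ φ.boundary V, g x = h x) ∧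
        ∀ a ∈ φ.componentAtoms V, a.toPP.Sat g := by
    intro V
    obtain ⟨Θ, hf, hw, hΘ⟩ := PPFormula.exists_quantify_to hℓ' hℓm (φ.boundary V) (hboundk V)
      ((φ.componentAtoms V).toList.map Atom.toPP)
      (by
        intro θ hθ
        obtain ⟨a, ha, rfl⟩ := List.mem_map.1 hθ
        exact hatomw a (Finset.mem_filter.1 (Finset.mem_toList.1 ha)).1)
      (by
        intro θ hθ
        obtain ⟨a, ha, rfl⟩ := List.mem_map.1 hθ
        exact hatom a (Finset.mem_filter.1 (Finset.mem_toList.1 ha)).1)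
    refine ⟨Θ, hf, hw, fun B _ h => ?_⟩
    rw [hΘ]
    simp
  choose Θ hΘf hΘw hΘ using hpiece
  have := Fintype.ofFinite (φ.graph.induce φ.quantified).ConnectedComponent
  let libAtoms := φ.atoms.filter fun a => ∀ i, a.args i ∈ φ.lib
  let ps : List (PPFormula L) := libAtoms.toList.map Atom.toPP ++ Finset.univ.toList.map Θ
  have hps : ∀ θ ∈ ps, (∃ b ∈ ℓ, θ.free ⊆ b) ∧ θ.width ≤ k + m := by
    intro θ hθ
    rcases List.mem_append.1 hθ with hθ | hθ
    · obtain ⟨a, ha, rfl⟩ := List.mem_map.1 hθ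
      obtain ⟨ha, halib⟩ := Finset.mem_filter.1 (Finset.mem_toList.1 ha)
      refine ⟨?_, (hatomw a ha).trans (Nat.le_add_left _ _)⟩
      have hKlib : (a.toPP.free : Set ℕ) ⊆ φ.lib := fun x hx => by
        obtain ⟨i, rfl⟩ := Atom.mem_free_toPP.1 hx
        exact halib i
      refine hclique _ hKlib fun x hx y hy hxy => ?_
      obtain ⟨i, rfl⟩ := Atom.mem_free_toPP.1 hx
      obtain ⟨j, rfl⟩ := Atom.mem_free_toPP.1 hy
      exact ⟨fun h => hxy (congrArg Subtype.val h), Or.inl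
        ⟨fun h => hxy (congrArg Subtype.val h), a, ha, ⟨i, rfl⟩, ⟨j, rfl⟩⟩⟩
    · obtain ⟨V, -, rfl⟩ := List.mem_map.1 hθ
      obtain ⟨b, hb, hbV⟩ := hbound V
      exact ⟨⟨b, hb, (hΘf V).trans hbV⟩, hΘw V⟩
  obtain ⟨Ψ, hw, hf, hsw, hww, hΨ⟩ := SharpPP.exists_sum_along hℓ (Nat.le_add_right k m) hℓk
    (ps.map fun θ => SharpPP.cast θ θ.free)
    (by
      intro q hq
      obtain ⟨θ, -, rfl⟩ := List.mem_map.1 hq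
      exact subset_rfl)
    (by
      intro q hq
      obtain ⟨θ, hθ, rfl⟩ := List.mem_map.1 hq
      exact (hps θ hθ).1)
    (by
      intro q hq
      obtain ⟨θ, -, rfl⟩ := List.mem_map.1 hq
      simp [SharpPP.closed])
    (by
      rw [List.pairwise_map]
      exact List.pairwise_of_forall fun _ _ => by simp [SharpPP.closed])
    (by
      intro q hq
      obtain ⟨θ, hθ, rfl⟩ := List.mem_map.1 hq
      obtain ⟨⟨b, hb, hθb⟩, -⟩ := hps θ hθ
      exact (Finset.card_le_card hθb).trans (hℓk b hb))
    (by
      intro q hq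
      obtain ⟨θ, hθ, rfl⟩ := List.mem_map.1 hq
      exact max_le ((PPFormula.card_free_le_width θ).trans (hps θ hθ).2) (hps θ hθ).2)
  refine ⟨Ψ, ⟨hw, hf, fun B _ _ _ h => ?_⟩, hsw, hww⟩
  rw [hΨ B h, hU]
  -- The product of the 0/1 factors is the indicator function of the answers, so the sum over all
  -- assignments of `φ.lib` counts them.
  have hval : ∀ f : φ.lib → B, ((ps.map fun θ => SharpPP.cast θ θ.free).map fun q =>
      q.eval (SharpPP.override h φ.lib f)).prod = if f ∈ φ.answers B then 1 else 0 := by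
    intro f
    rw [List.map_map]
    change (ps.map fun θ => if θ.Sat (SharpPP.override h φ.lib f) then (1 : ℤ) else 0).prod = _
    rw [SharpPP.prod_map_ite]
    refine if_congr ?_ rfl rfl
    rw [φ.mem_answers_iff f h]
    simp only [ps, List.mem_append, List.mem_map, Finset.mem_toList, libAtoms, Finset.mem_filter,
      Finset.mem_univ, true_and]
    constructor
    · intro hs
      exact ⟨fun a ha hl => hs _ (Or.inl ⟨a, ⟨ha, hl⟩, rfl⟩),
        fun V => (hΘ V B _).1 (hs _ (Or.inr ⟨V, rfl⟩))⟩
    · rintro ⟨h₁, h₂⟩ _ (⟨a, ⟨ha, hl⟩, rfl⟩ | ⟨V, rfl⟩)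
      · exact h₁ a ha hl
      · exact (hΘ V B _).2 (h₂ V)
  simp only [hval]
  rw [Finset.sum_boole, Set.ncard_eq_toFinset_card']
  congr 2
  ext f
  simp

/-! ### Cores -/

theorem exists_isCore (φ : PrenexPP L) : ∃ ψ : PrenexPP L, ψ.IsCore φ := by
  classical
  have hid : φ.IsFixingEndo id := ⟨fun _ h => h, fun _ h => h, fun _ _ => rfl⟩
  let P : Set ℕ := {n | ∃ c, φ.IsFixingEndo c ∧ (φ.dom.image c).card = n}
  have hP : P.Nonempty := ⟨_, id, hid, rfl⟩
  obtain ⟨c, hc, hn⟩ := Nat.sInf_mem hP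
  refine ⟨⟨φ.dom.image c, φ.lib, fun s hs => ?_, φ.atoms.image (Atom.map c), ?_⟩, c, hc,
    fun d hd => hn.trans_le (Nat.sInf_le ⟨d, hd, rfl⟩), rfl, rfl, by simp⟩
  · exact Finset.mem_image.2 ⟨s, φ.lib_subset hs, hc.fixes s hs⟩
  · intro a ha i
    obtain ⟨b, hb, rfl⟩ := Finset.mem_image.1 ha
    exact Finset.mem_image_of_mem c (φ.args_mem b hb i)

theorem IsCore.atoms_subset {ψ φ : PrenexPP L} (h : ψ.IsCore φ) : ψ.atoms ⊆ φ.atoms := by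
  obtain ⟨c, hc, -, -, -, hat⟩ := h
  intro a ha
  have : a ∈ (ψ.atoms : Set (Atom L)) := ha
  rw [hat] at this
  obtain ⟨b, hb, rfl⟩ := this
  exact hc.hom b hb

theorem IsCore.dom_subset {ψ φ : PrenexPP L} (h : ψ.IsCore φ) : ψ.dom ⊆ φ.dom := by
  obtain ⟨c, hc, -, -, hdom, -⟩ := h
  rw [hdom]
  intro x hx
  obtain ⟨y, hy, rfl⟩ := Finset.mem_image.1 hx
  exact hc.mapsTo y hy

/-- The core has the same answers: a satisfying assignment of the core composed with `c` satisfies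
`φ`, and one of `φ` restricts to the core, whose atoms are atoms of `φ`. -/
theorem IsCore.represents {ψ φ : PrenexPP L} (h : ψ.IsCore φ) {θ : SharpPP L}
    (hθ : θ.Represents ψ) : θ.Represents φ := by
  refine ⟨hθ.1, hθ.2.1, fun B _ _ _ h' => (hθ.2.2 B h').trans ?_⟩
  have hsub := h.atoms_subset
  have hdsub := h.dom_subset
  obtain ⟨c, hc, -, hlib, hdom, hat⟩ := h
  -- The two sets of liberal variables are identified first, so that the two sets of answers have
  -- the same type.
  obtain ⟨D, S, hS, A, hA⟩ := ψ
  simp only at hlib hdom hat hsub hdsub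
  subst hlib
  congr 2
  ext f
  constructor
  · rintro ⟨g, hg, hs⟩
    have hcD : ∀ x ∈ φ.dom, c x ∈ D := fun x hx => hdom ▸ Finset.mem_image_of_mem c hx
    refine ⟨fun x => g ⟨c x, hcD x x.2⟩, fun s => ?_, fun a ha => ?_⟩
    · rw [← hg s]
      simp only [hc.fixes s s.2]
    · have : a.map c ∈ A := by
        have : a.map c ∈ (A : Set (Atom L)) := hat ▸ ⟨a, ha, rfl⟩
        exact this
      exact hs _ this
  · rintro ⟨g, hg, hs⟩
    exact ⟨fun x => g ⟨x, hdsub x.2⟩, hg, fun a ha => hs a (hsub ha)⟩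

end PrenexPP

end SharpLogic

namespace SharpLogic

/-! ### Queries with variables in arbitrary finite types -/

/-- An atom with variables in a type. -/
structure VarAtom (L : FirstOrder.Language.{0, v}) (X : Type) where
  arity : ℕ
  rel : L.Relations arity
  args : Fin arity → X

/-- Rename the variables of an atom. -/
def VarAtom.map {L : FirstOrder.Language.{0, v}} {X Y : Type} (g : X → Y) (a : VarAtom L X) : VarAtom L Y :=
  ⟨a.arity, a.rel, g ∘ a.args⟩

/-- An atom holds under an assignment. -/
def VarAtom.Holds {L : FirstOrder.Language.{0, v}} {X B : Type} [L.Structure B] (a : VarAtom L X)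
    (g : X → B) : Prop :=
  FirstOrder.Language.Structure.RelMap a.rel (g ∘ a.args)

/-- A prenex pp-formula with variables in a finite type, whose liberal variables are indexed by
another finite type. -/
structure Query (L : FirstOrder.Language.{0, v}) where
  X : Type
  S : Type
  [finiteX : Finite X]
  [finiteS : Finite S]
  ι : S → X
  injective : Function.Injective ι
  atoms : Set (VarAtom L X)

attribute [instance] Query.finiteX Query.finiteS

/-- A finite structure with nonempty universe. -/
structure FinStr (L : FirstOrder.Language.{0, v}) where
  B : Type
  [fintype : Fintype B]
  [nonempty : Nonempty B]
  [str : L.Structure B]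

attribute [instance] FinStr.fintype FinStr.nonempty FinStr.str

variable {L : FirstOrder.Language.{0, v}}

/-- The structure with given relations, over a relational language. -/
@[reducible] def relStructure [L.IsRelational] (B : Type)
    (R : ∀ n, L.Relations n → (Fin n → B) → Prop) : L.Structure B where
  funMap f := isEmptyElim f
  RelMap := R _

namespace Query

/-- The satisfying assignments of the liberal variables. -/
def answers (q : Query L) (B : Type) [L.Structure B] : Set (q.S → B) :=
  {f | ∃ g : q.X → B, g ∘ q.ι = f ∧ ∀ a ∈ q.atoms, a.Holds g}

/-- The number of satisfying assignments. -/
noncomputable def count (q : Query L) (M : FinStr L) : ℕ := (q.answers M.B).ncard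

variable [L.IsRelational]

/-! ### Products of structures and linear independence of counts -/

/-- The direct product of two structures. -/
def prodStr (M N : FinStr L) : FinStr L where
  B := M.B × N.B
  str := relStructure _ fun _ R x => FirstOrder.Language.Structure.RelMap R (Prod.fst ∘ x) ∧
    FirstOrder.Language.Structure.RelMap R (Prod.snd ∘ x)

theorem count_prodStr (q : Query L) (M N : FinStr L) :
    q.count (prodStr M N) = q.count M * q.count N := by
  let e : (q.S → (prodStr M N).B) ≃ (q.S → M.B) × (q.S → N.B) :=
    Equiv.arrowProdEquivProdArrow q.S (fun _ => M.B) (fun _ => N.B)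
  unfold count
  rw [← Set.ncard_prod]
  refine (Set.ncard_image_of_injective _ e.injective).symm.trans (congrArg Set.ncard ?_)
  ext ⟨f, f'⟩
  constructor
  · rintro ⟨_, ⟨g, rfl, hg⟩, h⟩
    rw [← h]
    exact ⟨⟨Prod.fst ∘ g, rfl, fun a ha => (hg a ha).1⟩,
      ⟨Prod.snd ∘ g, rfl, fun a ha => (hg a ha).2⟩⟩
  · rintro ⟨⟨g, rfl, hg⟩, ⟨g', rfl, hg'⟩⟩
    exact ⟨_, ⟨fun x => (g x, g' x), rfl, fun a ha => ⟨hg a ha, hg' a ha⟩⟩, rfl⟩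

/-- The structure with one element and full relations. -/
def unitStr (L : FirstOrder.Language.{0, v}) [L.IsRelational] : FinStr L where
  B := Unit
  str := relStructure _ fun _ _ _ => True

theorem count_unitStr (q : Query L) : q.count (unitStr L) = 1 := by
  have : q.answers (unitStr L).B = {fun _ => ()} := by
    ext f
    exact ⟨fun _ => rfl, fun _ => ⟨fun _ => (), rfl, fun _ _ => trivial⟩⟩
  exact (congrArg Set.ncard this).trans (Set.ncard_singleton _)

/-- Counting as a multiplicative function on lists of structures. -/
noncomputable def char (q : Query L) : FreeMonoid (FinStr L) →* ℤ :=
  FreeMonoid.lift fun M => (q.count M : ℤ)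

/-- Direct products are associative only up to isomorphism, so counts are made into characters of
the free monoid on structures. A word can be replaced by the product of its letters for all queries
at once, which extends identities between counts to identities between characters. -/
theorem exists_char_eq_count (w : FreeMonoid (FinStr L)) :
    ∃ M : FinStr L, ∀ q : Query L, q.char w = q.count M := by
  induction w using FreeMonoid.inductionOn' with
  | one => exact ⟨unitStr L, fun q => by simp [count_unitStr]⟩
  | of_mul M w ih =>
    obtain ⟨N, hN⟩ := ih
    exact ⟨prodStr M N, fun q => by rw [map_mul, hN, count_prodStr]; simp [char]⟩

/-- If counting answers to a query is a linear combination of counting answers to other queries,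
then it agrees with counting answers to one of them. -/
theorem exists_count_eq_of_linearCombination (q : Query L) (cs : List (ℤ × Query L))
    (h : ∀ M, (q.count M : ℤ) = (cs.map fun p => p.1 * (p.2.count M : ℤ)).sum) :
    ∃ p ∈ cs, ∀ M, q.count M = p.2.count M := by
  -- Dedekind's theorem: distinct characters with values in a domain are linearly independent, so
  -- `q.char` lies in the span of the others only if it is one of them.
  have hli := linearIndependent_monoidHom (FreeMonoid (FinStr L)) ℤ
  let s : Set (FreeMonoid (FinStr L) →* ℤ) := {χ | ∃ p ∈ cs, χ = p.2.char}
  have hspan : (q.char : FreeMonoid (FinStr L) → ℤ) ∈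
      Submodule.span ℤ ((fun χ : FreeMonoid (FinStr L) →* ℤ =>
        (χ : FreeMonoid (FinStr L) → ℤ)) '' s) := by
    have heq : (q.char : FreeMonoid (FinStr L) → ℤ) =
        (cs.map fun p => p.1 • (p.2.char : FreeMonoid (FinStr L) → ℤ)).sum := by
      funext w
      obtain ⟨M, hM⟩ := exists_char_eq_count w
      rw [hM, h, Pi.list_sum_apply, List.map_map]
      congr 1
      refine List.map_congr_left fun p _ => ?_
      simp [hM]
    rw [heq]
    refine list_sum_mem fun x hx => ?_
    obtain ⟨p, hp, rfl⟩ := List.mem_map.1 hx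
    exact Submodule.smul_mem _ _ (Submodule.subset_span ⟨_, ⟨p, hp, rfl⟩, rfl⟩)
  by_cases hs : q.char ∈ s
  · obtain ⟨p, hp, hqp⟩ := hs
    refine ⟨p, hp, fun M => ?_⟩
    have := DFunLike.congr_fun hqp (FreeMonoid.of M)
    simpa [char] using this
  · exact absurd hspan (hli.notMem_span_image hs)

/-! ### Blow-ups of structures and homomorphisms from equal counts -/

/-- The structure obtained by replacing each element `b` by `n b + 1` copies. -/
def blowup (M : FinStr L) (n : M.B → ℕ) : FinStr L where
  -- At least one copy of each element is kept, so that quantified variables always retain a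
  -- witness.
  B := Σ b : M.B, Fin (n b + 1)
  nonempty := ⟨⟨Classical.arbitrary M.B, 0⟩⟩
  str := relStructure _ fun _ R x => FirstOrder.Language.Structure.RelMap R (Sigma.fst ∘ x)

/-- The generating polynomial of the answers, by the numbers of times that elements of the
structure appear as values. -/
noncomputable def answerPoly (q : Query L) (M : FinStr L) : MvPolynomial M.B ℤ :=
  letI := Fintype.ofFinite q.S
  ∑ f ∈ (Set.toFinite (q.answers M.B)).toFinset,
    MvPolynomial.monomial (∑ s, Finsupp.single (f s) 1) 1

/-- An answer on the blow-up is an answer on `M` with a copy chosen for each liberal variable.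
Quantified variables contribute no factor, since some copy (here copy 0) always works. -/
theorem eval_answerPoly (q : Query L) (M : FinStr L) (n : M.B → ℕ) :
    MvPolynomial.eval (fun b => (n b + 1 : ℤ)) (q.answerPoly M) = q.count (blowup M n) := by
  classical
  let := Fintype.ofFinite q.S
  have hmem : ∀ F : q.S → Σ b : M.B, Fin (n b + 1),
      F ∈ q.answers (blowup M n).B ↔ (fun s => (F s).1) ∈ q.answers M.B := by
    intro F
    constructor
    · rintro ⟨g, rfl, hg⟩
      exact ⟨Sigma.fst ∘ g, rfl, fun a ha => hg a ha⟩
    · rintro ⟨g, hgF, hg⟩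
      have hfst : Sigma.fst ∘ Function.extend q.ι F (fun x => ⟨g x, 0⟩) = g := by
        funext x
        by_cases hx : ∃ s, q.ι s = x
        · obtain ⟨s, rfl⟩ := hx
          rw [Function.comp_apply, q.injective.extend_apply]
          exact (congrFun hgF s).symm
        · rw [Function.comp_apply, Function.extend_apply' _ _ _ hx]
      refine ⟨Function.extend q.ι F (fun x => ⟨g x, 0⟩),
        funext fun s => q.injective.extend_apply _ _ s, fun a ha => ?_⟩
      change FirstOrder.Language.Structure.RelMap a.rel
        ((Sigma.fst ∘ Function.extend q.ι F (fun x => ⟨g x, 0⟩)) ∘ a.args)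
      rw [hfst]
      exact hg a ha
  let e : (q.answers (blowup M n).B) ≃ Σ f : q.answers M.B, ∀ s, Fin (n (f.1 s) + 1) :=
    { toFun := fun F => ⟨⟨fun s => (F.1 s).1, (hmem F.1).1 F.2⟩, fun s => (F.1 s).2⟩
      invFun := fun p => ⟨fun s => ⟨p.1.1 s, p.2 s⟩, (hmem _).2 p.1.2⟩
      left_inv := fun _ => rfl
      right_inv := fun _ => rfl }
  have hcount : q.count (blowup M n) =
      ∑ f ∈ (Set.toFinite (q.answers M.B)).toFinset, ∏ s, (n (f s) + 1) := by
    rw [count, ← Nat.card_coe_set_eq, Nat.card_congr e, Nat.card_eq_fintype_card,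
      Fintype.card_sigma]
    simp only [Fintype.card_pi, Fintype.card_fin]
    exact (Finset.sum_subtype _ (fun f => Set.Finite.mem_toFinset _)
      fun f : q.S → M.B => ∏ s, (n (f s) + 1)).symm
  rw [hcount, answerPoly, map_sum]
  push_cast
  refine Finset.sum_congr (by congr!) fun f _ => ?_
  rw [MvPolynomial.monomial_sum_one, map_prod]
  refine Finset.prod_congr (by congr!) fun s _ => ?_
  rw [MvPolynomial.eval_monomial]
  simp

/-- If two queries have the same numbers of answers, then each injective answer to the first is an
answer to the second, up to a bijection between the liberal variables. -/
theorem exists_answer_of_count_eq {q q' : Query L} (h : ∀ M, q.count M = q'.count M)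
    {M : FinStr L} {f : q.S → M.B} (hf : f ∈ q.answers M.B) (hinj : Function.Injective f) :
    ∃ σ : q'.S ≃ q.S, f ∘ σ ∈ q'.answers M.B := by
  classical
  let := Fintype.ofFinite q.S
  let := Fintype.ofFinite q'.S
  -- Equal counts on all blow-ups mean that the polynomials agree at all points with positive
  -- integer coordinates, hence are equal.
  have hpoly : q.answerPoly M = q'.answerPoly M := by
    refine MvPolynomial.funext_set (fun _ => Set.range fun n : ℕ => (n + 1 : ℤ)) (fun _ =>
      Set.infinite_range_of_injective fun a b hab => by simpa using hab) fun x hx => ?_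
    choose n hn using fun b => hx b trivial
    obtain rfl : (fun b => (n b + 1 : ℤ)) = x := funext hn
    rw [eval_answerPoly, eval_answerPoly, h]
  have hcoeff : ∀ (p : Query L) [Fintype p.S] (e : M.B →₀ ℕ), MvPolynomial.coeff e (p.answerPoly M) =
      ((Set.toFinite (p.answers M.B)).toFinset.filter
        fun f => ∑ s, Finsupp.single (f s) 1 = e).card := by
    intro p _ e
    rw [answerPoly, MvPolynomial.coeff_sum]
    simp only [MvPolynomial.coeff_monomial]
    rw [Finset.sum_boole]
    congr!
  -- The coefficient at the monomial of `f` counts the answers that take each value as often as `f`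
  -- does. It is positive for `q`, hence for `q'`.
  have hpos : 0 < ((Set.toFinite (q'.answers M.B)).toFinset.filter
        fun f' => ∑ s, Finsupp.single (f' s) 1 = ∑ s, Finsupp.single (f s) 1).card := by
    have := (hcoeff q (∑ s, Finsupp.single (f s) 1)).symm.trans (hpoly ▸ hcoeff q' _)
    rw [← Nat.cast_inj (R := ℤ).1 this, Finset.card_pos]
    exact ⟨f, by simp [hf]⟩
  obtain ⟨f', hf'⟩ := Finset.card_pos.1 hpos
  rw [Finset.mem_filter, Set.Finite.mem_toFinset] at hf'
  obtain ⟨hf', hsum⟩ := hf'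
  have hcard : ∀ x : M.B, (Finset.univ.filter fun s => f' s = x).card =
      (Finset.univ.filter fun s => f s = x).card := fun x => by
    have := DFunLike.congr_fun hsum x
    simpa [Finsupp.finsetSum_apply, Finsupp.single_apply, Finset.sum_boole] using this
  have hrange : ∀ s', ∃ s, f s = f' s' := fun s' => by
    have h0 : 0 < (Finset.univ.filter fun s => f' s = f' s').card :=
      Finset.card_pos.2 ⟨s', by simp⟩
    rw [hcard] at h0
    obtain ⟨s, hs⟩ := Finset.card_pos.1 h0
    exact ⟨s, (Finset.mem_filter.1 hs).2⟩
  choose σ hσ using hrange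
  -- As `f` is injective, each value is taken at most once by `f`, and therefore by `f'`; so `f` and
  -- `f'` differ by a bijection of their index sets.
  have hbij : Function.Bijective σ := by
    constructor
    · intro s s' hss
      have h1 : (Finset.univ.filter fun t => f' t = f' s').card ≤ 1 := by
        rw [hcard]
        refine Finset.card_le_one.2 fun a ha b hb => hinj ?_
        rw [(Finset.mem_filter.1 ha).2, (Finset.mem_filter.1 hb).2]
      refine Finset.card_le_one.1 h1 s ?_ s' (by simp)
      simp [← hσ, hss]
    · intro s
      have h0 : 0 < (Finset.univ.filter fun t => f t = f s).card :=
        Finset.card_pos.2 ⟨s, by simp⟩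
      rw [← hcard] at h0
      obtain ⟨s', hs'⟩ := Finset.card_pos.1 h0
      refine ⟨s', hinj ?_⟩
      rw [hσ]
      exact (Finset.mem_filter.1 hs').2
  refine ⟨Equiv.ofBijective σ hbij, ?_⟩
  have : f ∘ Equiv.ofBijective σ hbij = f' := funext hσ
  rwa [this]

/-- The structure of a query, in which the atoms are the tuples that are related. -/
noncomputable def canonicalStr (q : Query L) [Nonempty q.X] : FinStr L where
  B := q.X
  fintype := Fintype.ofFinite q.X
  str := relStructure _ fun n R x => (⟨n, R, x⟩ : VarAtom L q.X) ∈ q.atoms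

/-- If two queries have the same numbers of answers, then there is a homomorphism from the second
to the first that is bijective on the liberal variables. -/
theorem exists_hom_of_count_eq {q q' : Query L} (h : ∀ M, q.count M = q'.count M) [Nonempty q.X] :
    ∃ (g : q'.X → q.X) (σ : q'.S ≃ q.S), (∀ s, g (q'.ι s) = q.ι (σ s)) ∧
      ∀ a ∈ q'.atoms, a.map g ∈ q.atoms := by
  -- On the structure of `q` itself the identity witnesses the injective answer `q.ι`. A witness for
  -- the matching answer to `q'` is the homomorphism sought.
  obtain ⟨σ, g, hgσ, hg⟩ := exists_answer_of_count_eq h (M := q.canonicalStr) (f := q.ι)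
    ⟨id, rfl, fun a ha => ha⟩ q.injective
  exact ⟨g, σ, congrFun hgσ, hg⟩

end Query

/-! ### The query of a prenex pp-formula, and embeddings of its core -/

namespace PrenexPP

/-- An atom with variables in a finite set as an atom. -/
def _root_.SharpLogic.VarAtom.toAtom {D : Finset ℕ} (a : VarAtom L D) : Atom L :=
  ⟨a.arity, a.rel, fun i => a.args i⟩

/-- The query of a prenex pp-formula. -/
def toQuery (φ : PrenexPP L) : Query L where
  X := φ.dom
  S := φ.lib
  ι := φ.ofLib
  injective := fun _ _ h => Subtype.ext (congrArg (fun x : φ.dom => (x : ℕ)) h)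
  atoms := {a | a.toAtom ∈ φ.atoms}

theorem answers_toQuery (φ : PrenexPP L) (B : Type) [L.Structure B] :
    φ.toQuery.answers B = φ.answers B := by
  ext f
  constructor
  · rintro ⟨g, rfl, hg⟩
    exact ⟨g, fun s => rfl, fun a ha => hg ⟨a.arity, a.rel, fun i => ⟨a.args i, φ.args_mem a ha i⟩⟩ ha⟩
  · rintro ⟨g, hgf, hg⟩
    exact ⟨g, funext hgf, fun a ha => hg a.toAtom ha⟩

/-- A core embeds into each query that has the same numbers of answers. -/
theorem IsCore.exists_injective [L.IsRelational] {ψ φ : PrenexPP L} (hψ : ψ.IsCore φ)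
    {q : Query L} (h : ∀ M, φ.toQuery.count M = q.count M) (hφ : φ.dom.Nonempty)
    [Nonempty q.X] :
    ∃ e : ψ.dom → q.X, Function.Injective e ∧
      (∀ x : ψ.dom, (x : ℕ) ∈ ψ.lib ↔ ∃ s, q.ι s = e x) ∧
      ∀ a : VarAtom L ψ.dom, a.toAtom ∈ ψ.atoms → a.map e ∈ q.atoms := by
  classical
  have : Nonempty φ.toQuery.X := ⟨⟨hφ.choose, hφ.choose_spec⟩⟩
  obtain ⟨g, τ, hgτ, hg⟩ := Query.exists_hom_of_count_eq h
  obtain ⟨f, σ, hfσ, hf⟩ := Query.exists_hom_of_count_eq fun M => (h M).symm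
  -- The composite of the two homomorphisms is an endomorphism of `φ` that permutes the liberal
  -- variables by `π`; its power by the order of `π` fixes them. As this order is positive, `f` is
  -- applied first in the power, so elements identified by `f` are identified by the power.
  let π : Equiv.Perm φ.toQuery.S := σ.trans τ
  obtain ⟨n, hn, hπ⟩ : ∃ n, 0 < n ∧ π ^ n = 1 := ⟨_, orderOf_pos π, pow_orderOf_eq_one π⟩
  obtain ⟨n, rfl⟩ := Nat.exists_eq_succ_of_ne_zero hn.ne'
  let k : φ.dom → φ.dom := fun x => g (f x)
  have hkatoms : ∀ (m : ℕ) (a : VarAtom L φ.dom), a.toAtom ∈ φ.atoms →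
      (a.map (k^[m])).toAtom ∈ φ.atoms := by
    intro m
    induction m with
    | zero => exact fun a ha => ha
    | succ m ih => exact fun a ha => ih (a.map k) (hg _ (hf _ ha))
  have hklib : ∀ (m : ℕ) (s : φ.toQuery.S), k^[m] (φ.ofLib s) = φ.ofLib ((π ^ m) s) := by
    intro m
    induction m with
    | zero => exact fun s => rfl
    | succ m ih =>
      intro s
      have : k (φ.ofLib s) = φ.ofLib (π s) := by
        change g (f (φ.toQuery.ι s)) = _
        rw [hfσ, hgτ]
        rfl
      rw [Function.iterate_succ_apply, this, ih, pow_succ]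
      rfl
  let d : φ.dom → φ.dom := k^[n + 1]
  let d' : ℕ → ℕ := fun x => if hx : x ∈ φ.dom then d ⟨x, hx⟩ else x
  have hd' : ∀ {x} (hx : x ∈ φ.dom), d' x = d ⟨x, hx⟩ := fun hx => dif_pos hx
  have hendo : φ.IsFixingEndo d' := by
    refine ⟨fun x hx => hd' hx ▸ (d ⟨x, hx⟩).2, fun a ha => ?_, fun s hs => ?_⟩
    · have := hkatoms (n + 1) ⟨a.arity, a.rel, fun i => ⟨a.args i, φ.args_mem a ha i⟩⟩ ha
      convert this using 1
      simp only [Atom.map, VarAtom.toAtom, VarAtom.map, Atom.mk.injEq, heq_eq_eq, true_and]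
      exact funext fun i => hd' (φ.args_mem a ha i)
    · rw [hd' (φ.lib_subset hs)]
      have := hklib (n + 1) ⟨s, hs⟩
      rw [hπ] at this
      exact congrArg Subtype.val this
  have hatsub := hψ.atoms_subset
  have hdsub := hψ.dom_subset
  obtain ⟨c, hc, hmin, hlib, hdom, hat⟩ := hψ
  have hcomp : φ.IsFixingEndo (c ∘ d' ∘ c) :=
    ⟨fun x hx => hc.mapsTo _ (hendo.mapsTo _ (hc.mapsTo _ hx)),
      fun a ha => hc.hom _ (hendo.hom _ (hc.hom _ ha)),
      fun s hs => by simp [hc.fixes s hs, hendo.fixes s hs]⟩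
  -- Minimality of the core, applied to `c ∘ d' ∘ c`, shows that `c ∘ d'` identifies no two elements
  -- of the core; hence neither does `f`.
  have hinj : Set.InjOn (c ∘ d') ψ.dom := by
    refine Finset.injOn_of_card_image_eq (le_antisymm Finset.card_image_le ?_)
    rw [hdom, Finset.image_image]
    exact hmin _ hcomp
  let e : ψ.dom → q.X := fun x => f ⟨x, hdsub x.2⟩
  have he : Function.Injective e := by
    intro x y hxy
    refine Subtype.ext (hinj x.2 y.2 ?_)
    have hxy' : f ⟨x, hdsub x.2⟩ = f ⟨y, hdsub y.2⟩ := hxy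
    have hd : d ⟨x, hdsub x.2⟩ = d ⟨y, hdsub y.2⟩ := congrArg (fun z => k^[n] (g z)) hxy'
    rw [Function.comp_apply, Function.comp_apply, hd' (hdsub x.2), hd' (hdsub y.2), hd]
  refine ⟨e, he, fun x => ⟨fun hx => ?_, ?_⟩, fun a ha => ?_⟩
  · exact ⟨σ ⟨x, hlib ▸ hx⟩, (hfσ ⟨x, hlib ▸ hx⟩).symm⟩
  -- Since `σ` is onto, every liberal variable of `q` is the image of a liberal variable; by
  -- injectivity no quantified variable of the core is sent there.
  · rintro ⟨s, hs⟩
    have hs' : f (φ.toQuery.ι (σ.symm s)) = e x := by rw [hfσ, Equiv.apply_symm_apply, hs]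
    let t : φ.lib := σ.symm s
    have hmem : (t : ℕ) ∈ ψ.lib := by rw [hlib]; exact t.2
    have : (⟨t, ψ.lib_subset hmem⟩ : ψ.dom) = x := he hs'
    rw [← this]
    exact hmem
  · exact hf ⟨a.arity, a.rel, fun i => ⟨a.args i, hdsub (a.args i).2⟩⟩ (hatsub ha)

end PrenexPP

end SharpLogic

namespace SharpLogic

variable {L : FirstOrder.Language.{0, v}}

/-! ### The prenex form of a primitive positive formula -/

namespace PPFormula

/-- The quantified variables of the prenex form of a formula. -/
def QVar : PPFormula L → Type
  -- The dummy variable occurs in no atom; it makes the type nonempty, so that the query has a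
  -- canonical structure.
  | top => Unit
  | rel _ _ => Unit
  | and φ ψ => φ.QVar ⊕ ψ.QVar
  | ex _ φ => Option φ.QVar

theorem finite_qVar (φ : PPFormula L) : Finite φ.QVar := by
  induction φ with
  | top => exact inferInstanceAs (Finite Unit)
  | rel R x => exact inferInstanceAs (Finite Unit)
  | and φ ψ ihφ ihψ => exact inferInstanceAs (Finite (φ.QVar ⊕ ψ.QVar))
  | ex x φ ih => exact inferInstanceAs (Finite (Option φ.QVar))

theorem nonempty_qVar (φ : PPFormula L) : Nonempty φ.QVar := by
  induction φ with
  | top => exact inferInstanceAs (Nonempty Unit)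
  | rel R x => exact inferInstanceAs (Nonempty Unit)
  | and φ ψ ihφ ihψ => exact inferInstanceAs (Nonempty (φ.QVar ⊕ ψ.QVar))
  | ex x φ ih => exact inferInstanceAs (Nonempty (Option φ.QVar))

instance (φ : PPFormula L) : Finite φ.QVar := φ.finite_qVar

instance (φ : PPFormula L) : Nonempty φ.QVar := φ.nonempty_qVar

/-- Turn a free variable into a quantified one. -/
def bindVar {Q : Type} (x : ℕ) : ℕ ⊕ Q → ℕ ⊕ Option Q :=
  Sum.elim (fun y => if y = x then .inr none else .inl y) (fun q => .inr (some q))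

theorem bindVar_injective {Q : Type} (x : ℕ) : Function.Injective (bindVar (Q := Q) x) := by
  rintro (y | q) (y' | q') h
  · simp only [bindVar, Sum.elim_inl] at h
    split_ifs at h <;> simp_all
  · simp only [bindVar, Sum.elim_inl, Sum.elim_inr] at h
    split_ifs at h
    simp at h
  · simp only [bindVar, Sum.elim_inl, Sum.elim_inr] at h
    split_ifs at h
    simp at h
  · simpa [bindVar] using h

theorem bindVar_eq_inl {Q : Type} {x y : ℕ} {z : ℕ ⊕ Q} :
    bindVar x z = .inl y ↔ z = .inl y ∧ y ≠ x := by
  rcases z with z | q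
  · simp only [bindVar, Sum.elim_inl]
    split_ifs with h
    · subst h; simp; rintro rfl; rfl
    · simp; rintro rfl; exact h
  · simp [bindVar]

theorem eq_inl_of_sumMap_eq_inl {Q Q' : Type} {j : Q → Q'} {z : ℕ ⊕ Q} {y : ℕ}
    (h : Sum.map id j z = .inl y) : z = .inl y := by
  rcases z with z | z
  · simpa using h
  · simp at h

/-- The atoms of the prenex form of a formula. -/
def matrix : (φ : PPFormula L) → Set (VarAtom L (ℕ ⊕ φ.QVar))
  | top => ∅
  | rel R x => {⟨_, R, Sum.inl ∘ x⟩}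
  | and φ ψ => VarAtom.map (Sum.map id Sum.inl) '' φ.matrix ∪
      VarAtom.map (Sum.map id Sum.inr) '' ψ.matrix
  | ex x φ => VarAtom.map (bindVar x) '' φ.matrix

theorem sat_iff {B : Type} [L.Structure B] (φ : PPFormula L) : ∀ h : ℕ → B,
    φ.Sat h ↔ ∃ q : φ.QVar → B, ∀ a ∈ φ.matrix, a.Holds (Sum.elim h q) := by
  induction φ with
  | top => exact fun h => ⟨fun _ => ⟨fun _ => h 0, by simp [matrix]⟩, fun _ => trivial⟩
  | rel R x =>
    intro h
    refine ⟨fun hs => ⟨fun _ => h 0, ?_⟩, ?_⟩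
    · rintro _ rfl
      exact hs
    · rintro ⟨q, hq⟩
      exact hq _ rfl
  | and φ ψ ihφ ihψ =>
    intro h
    have key₁ : ∀ (q : φ.QVar ⊕ ψ.QVar → B), Sum.elim h q ∘ Sum.map id Sum.inl =
        Sum.elim h (q ∘ Sum.inl) := fun q => by ext (x | x) <;> rfl
    have key₂ : ∀ (q : φ.QVar ⊕ ψ.QVar → B), Sum.elim h q ∘ Sum.map id Sum.inr =
        Sum.elim h (q ∘ Sum.inr) := fun q => by ext (x | x) <;> rfl
    constructor
    · rintro ⟨h₁, h₂⟩
      obtain ⟨q₁, hq₁⟩ := (ihφ h).1 h₁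
      obtain ⟨q₂, hq₂⟩ := (ihψ h).1 h₂
      refine ⟨Sum.elim q₁ q₂, ?_⟩
      rintro _ (⟨a, ha, rfl⟩ | ⟨a, ha, rfl⟩)
      · exact (congrArg a.Holds (key₁ (Sum.elim q₁ q₂))).mpr (hq₁ a ha)
      · exact (congrArg a.Holds (key₂ (Sum.elim q₁ q₂))).mpr (hq₂ a ha)
    · rintro ⟨q, hq⟩
      refine ⟨(ihφ h).2 ⟨q ∘ Sum.inl, fun a ha => ?_⟩, (ihψ h).2 ⟨q ∘ Sum.inr, fun a ha => ?_⟩⟩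
      · exact (congrArg a.Holds (key₁ q)).mp (hq _ (Or.inl ⟨a, ha, rfl⟩))
      · exact (congrArg a.Holds (key₂ q)).mp (hq _ (Or.inr ⟨a, ha, rfl⟩))
  | ex x φ ih =>
    intro h
    have key : ∀ (q : Option φ.QVar → B), Sum.elim h q ∘ bindVar x =
        Sum.elim (Function.update h x (q none)) (q ∘ some) := fun q => by
      ext (y | y)
      · simp only [Function.comp_apply, bindVar, Sum.elim_inl, Function.update_apply]
        split_ifs <;> rfl
      · rfl
    constructor
    · rintro ⟨b, hb⟩
      obtain ⟨q, hq⟩ := (ih _).1 hb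
      refine ⟨fun o => o.elim b q, ?_⟩
      rintro _ ⟨a, ha, rfl⟩
      exact (congrArg a.Holds (key fun o => o.elim b q)).mpr (hq a ha)
    · rintro ⟨q, hq⟩
      refine ⟨q none, (ih _).2 ⟨q ∘ some, fun a ha => ?_⟩⟩
      exact (congrArg a.Holds (key q)).mp (hq _ ⟨a, ha, rfl⟩)

theorem mem_free_of_mem_matrix (φ : PPFormula L) : ∀ a ∈ φ.matrix, ∀ i y,
    a.args i = .inl y → y ∈ φ.free := by
  induction φ with
  | top => simp [matrix]
  | rel R x =>
    rintro _ rfl i y hy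
    exact Finset.mem_image.2 ⟨i, Finset.mem_univ _, Sum.inl_injective hy⟩
  | and φ ψ ihφ ihψ =>
    rintro _ (⟨a, ha, rfl⟩ | ⟨a, ha, rfl⟩) i y hy
    · exact Finset.mem_union_left _ (ihφ a ha i y (eq_inl_of_sumMap_eq_inl hy))
    · exact Finset.mem_union_right _ (ihψ a ha i y (eq_inl_of_sumMap_eq_inl hy))
  | ex x φ ih =>
    rintro _ ⟨a, ha, rfl⟩ i y hy
    obtain ⟨hy, hne⟩ := bindVar_eq_inl.1 hy
    exact Finset.mem_erase.2 ⟨hne, ih a ha i y hy⟩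

/-- The query given by a formula and a set of liberal variables. -/
def toQuery (φ : PPFormula L) (S : Finset ℕ) : Query L where
  X := S ⊕ φ.QVar
  S := S
  ι := Sum.inl
  injective := Sum.inl_injective
  atoms := {a | a.map (Sum.map Subtype.val id) ∈ φ.matrix}

/-- The inclusion `hS` guarantees that every atom of the matrix lifts to an atom of the query, whose
named variables are restricted to `S`. -/
theorem mem_answers_toQuery {φ : PPFormula L} {S : Finset ℕ} (hS : φ.free ⊆ S) {B : Type}
    [L.Structure B] (h : ℕ → B) (f : S → B) :
    f ∈ (φ.toQuery S).answers B ↔ φ.Sat (SharpPP.override h S f) := by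
  have key : ∀ q : φ.QVar → B, Sum.elim (SharpPP.override h S f) q ∘ Sum.map Subtype.val id =
      Sum.elim f q := fun q => by
    ext (x | x)
    · exact SharpPP.override_of_mem _ _ x.2
    · rfl
  rw [sat_iff]
  constructor
  · rintro ⟨g, rfl, hg⟩
    refine ⟨g ∘ Sum.inr, fun a ha => ?_⟩
    have hargs : ∀ i, ∃ z : S ⊕ φ.QVar, Sum.map Subtype.val id z = a.args i := fun i => by
      rcases hi : a.args i with y | q
      · exact ⟨.inl ⟨y, hS (mem_free_of_mem_matrix φ a ha i y hi)⟩, rfl⟩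
      · exact ⟨.inr q, rfl⟩
    choose args hargs using hargs
    have ha' : (⟨a.arity, a.rel, args⟩ : VarAtom L (S ⊕ φ.QVar)).map (Sum.map Subtype.val id) = a := by
      obtain ⟨n, R, x⟩ := a
      simp only [VarAtom.map, VarAtom.mk.injEq, heq_eq_eq, true_and]
      exact funext hargs
    have hg' : Sum.elim (g ∘ (φ.toQuery S).ι) (g ∘ Sum.inr) = g := by
      ext (x | x) <;> rfl
    let a' : VarAtom L (S ⊕ φ.QVar) := ⟨a.arity, a.rel, args⟩
    rw [← ha']
    exact (congrArg a'.Holds ((key _).trans hg')).mpr (hg a' (by rw [← ha'] at ha; exact ha))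
  · rintro ⟨q, hq⟩
    refine ⟨Sum.elim f q, rfl, fun a ha => ?_⟩
    exact (congrArg a.Holds (key q)).mp (hq _ ha)

/-- A join tree for the atoms of a prenex form, in which the free variables lie in the root. -/
structure IsJoinTree {Q : Type} (M : Set (VarAtom L (ℕ ⊕ Q))) (F C : Finset ℕ) (k : ℕ)
    (r : Finset (ℕ ⊕ Q)) (l : List (Finset (ℕ ⊕ Q))) : Prop where
  running : RunningIntersection r l
  card_le : ∀ b ∈ l, b.card ≤ k
  -- All named variables outside `F` are confined to `C`. Two trees with disjoint `C` thus share
  -- only named variables of `F`, which lie in both roots.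
  mem : ∀ b ∈ l, ∀ y, .inl y ∈ b → y ∈ F ∪ C
  mem_root : ∀ y ∈ F, .inl y ∈ r
  atom : ∀ a ∈ M, ∃ b ∈ l, ∀ i, a.args i ∈ b

theorem IsJoinTree.map {Q Q' : Type} {M : Set (VarAtom L (ℕ ⊕ Q))} {F C : Finset ℕ} {k : ℕ}
    {r : Finset (ℕ ⊕ Q)} {l : List (Finset (ℕ ⊕ Q))} (h : IsJoinTree M F C k r l)
    [DecidableEq (ℕ ⊕ Q')] {j : Q → Q'} (hj : Function.Injective j) :
    IsJoinTree (VarAtom.map (Sum.map id j) '' M) F C k (r.image (Sum.map id j))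
      (l.map (Finset.image (Sum.map id j))) where
  running := h.running.map_injective (Function.injective_id.sumMap hj)
  card_le b hb := by
    obtain ⟨c, hc, rfl⟩ := List.mem_map.1 hb
    exact Finset.card_image_le.trans (h.card_le c hc)
  mem b hb y hy := by
    obtain ⟨c, hc, rfl⟩ := List.mem_map.1 hb
    obtain ⟨z, hz, hzy⟩ := Finset.mem_image.1 hy
    exact h.mem c hc y (eq_inl_of_sumMap_eq_inl hzy ▸ hz)
  mem_root y hy := Finset.mem_image.2 ⟨_, h.mem_root y hy, rfl⟩
  atom a ha := by
    obtain ⟨a, ha, rfl⟩ := ha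
    obtain ⟨b, hb, hab⟩ := h.atom a ha
    exact ⟨_, List.mem_map_of_mem hb, fun i => Finset.mem_image_of_mem _ (hab i)⟩

/-- Attach a join tree below a new root. -/
theorem IsJoinTree.newRoot {Q : Type} [DecidableEq (ℕ ⊕ Q)] {M : Set (VarAtom L (ℕ ⊕ Q))}
    {F C V : Finset ℕ} {k : ℕ}
    {r : Finset (ℕ ⊕ Q)} {l : List (Finset (ℕ ⊕ Q))} (h : IsJoinTree M F C k r l)
    (hV : V.card ≤ k) (hF : F ⊆ V) (hC : Disjoint V C) :
    IsJoinTree M V C k (V.image .inl) (l ++ [V.image .inl]) where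
  running := by
    refine RunningIntersection.root.append (p := V.image .inl) h.running (by simp) fun b hb b' hb' x hx hx' => ?_
    rw [List.mem_singleton] at hb
    subst hb
    refine ⟨hx, ?_⟩
    obtain ⟨y, hy, rfl⟩ := Finset.mem_image.1 hx
    rcases Finset.mem_union.1 (h.mem b' hb' y hx') with hy' | hy'
    · exact h.mem_root y hy'
    · exact absurd hy' (Finset.disjoint_left.1 hC hy)
  card_le b hb := by
    rcases List.mem_append.1 hb with hb | hb
    · exact h.card_le b hb
    · rw [List.mem_singleton.1 hb]
      exact Finset.card_image_le.trans hV
  mem b hb y hy := by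
    rcases List.mem_append.1 hb with hb | hb
    · exact Finset.union_subset_union_left hF (h.mem b hb y hy)
    · rw [List.mem_singleton.1 hb] at hy
      exact Finset.mem_union_left _ (by simpa using hy)
  mem_root y hy := Finset.mem_image_of_mem _ hy
  atom a ha := by
    obtain ⟨b, hb, hab⟩ := h.atom a ha
    exact ⟨b, List.mem_append_left _ hb, hab⟩

/-- Join two trees at their roots. -/
theorem IsJoinTree.union {Q : Type} {M M' : Set (VarAtom L (ℕ ⊕ Q))}
    {F C C' : Finset ℕ} {k : ℕ} {r r' : Finset (ℕ ⊕ Q)} {l l' : List (Finset (ℕ ⊕ Q))}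
    (h : IsJoinTree M F C k r l) (h' : IsJoinTree M' F C' k r' l') (hC : Disjoint C C')
    (hQ : ∀ b ∈ l, ∀ b' ∈ l', ∀ q, .inr q ∈ b → .inr q ∉ b') :
    IsJoinTree (M ∪ M') F (C ∪ C') k r (l' ++ l) where
  running := by
    refine h.running.append h'.running h.running.root_mem fun b hb b' hb' x hx hx' => ?_
    rcases x with y | q
    · have hy : y ∈ F := by
        have h₁ := h.mem b hb y hx
        have h₂ := h'.mem b' hb' y hx'
        rw [Finset.mem_union] at h₁ h₂
        have : y ∈ C → y ∉ C' := fun h => Finset.disjoint_left.1 hC h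
        tauto
      exact ⟨h.mem_root y hy, h'.mem_root y hy⟩
    · exact absurd hx' (hQ b hb b' hb' q hx)
  card_le b hb := by
    rcases List.mem_append.1 hb with hb | hb
    exacts [h'.card_le b hb, h.card_le b hb]
  mem b hb y hy := by
    rcases List.mem_append.1 hb with hb | hb
    · have := h'.mem b hb y hy
      simp only [Finset.mem_union] at this ⊢
      tauto
    · have := h.mem b hb y hy
      simp only [Finset.mem_union] at this ⊢
      tauto
  mem_root := h.mem_root
  atom a ha := by
    rcases ha with ha | ha
    · obtain ⟨b, hb, hab⟩ := h.atom a ha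
      exact ⟨b, List.mem_append_right _ hb, hab⟩
    · obtain ⟨b, hb, hab⟩ := h'.atom a ha
      exact ⟨b, List.mem_append_left _ hb, hab⟩

theorem IsJoinTree.union_sum {Q Q' : Type} [DecidableEq (ℕ ⊕ (Q ⊕ Q'))]
    {M : Set (VarAtom L (ℕ ⊕ Q))} {M' : Set (VarAtom L (ℕ ⊕ Q'))}
    {F C C' : Finset ℕ} {k : ℕ} {r : Finset (ℕ ⊕ Q)} {l : List (Finset (ℕ ⊕ Q))}
    {r' : Finset (ℕ ⊕ Q')} {l' : List (Finset (ℕ ⊕ Q'))}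
    (h : IsJoinTree M F C k r l) (h' : IsJoinTree M' F C' k r' l') (hC : Disjoint C C') :
    ∃ r l, IsJoinTree (VarAtom.map (Sum.map id (Sum.inl : Q → Q ⊕ Q')) '' M ∪
      VarAtom.map (Sum.map id Sum.inr) '' M') F (C ∪ C') k r l := by
  refine ⟨_, _, (h.map Sum.inl_injective).union (h'.map Sum.inr_injective) hC ?_⟩
  intro b hb b' hb' q hq hq'
  obtain ⟨c, -, rfl⟩ := List.mem_map.1 hb
  obtain ⟨c', -, rfl⟩ := List.mem_map.1 hb'
  obtain ⟨z, -, hz⟩ := Finset.mem_image.1 hq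
  obtain ⟨z', -, hz'⟩ := Finset.mem_image.1 hq'
  rcases z with z | z
  · simp at hz
  · rcases z' with z' | z'
    · simp at hz'
    · rw [← hz'] at hz
      simp at hz

theorem IsJoinTree.mono {Q : Type} {M : Set (VarAtom L (ℕ ⊕ Q))} {F C : Finset ℕ} {k k' : ℕ}
    {r : Finset (ℕ ⊕ Q)} {l : List (Finset (ℕ ⊕ Q))} (h : IsJoinTree M F C k r l) (hk : k ≤ k') :
    IsJoinTree M F C k' r l :=
  ⟨h.running, fun b hb => (h.card_le b hb).trans hk, h.mem, h.mem_root, h.atom⟩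

/-- Bags are sets of free variables of subformulas: a conjunction puts a common new root above both
trees, and a quantifier only renames its variable, keeping the bags. -/
theorem exists_isJoinTree (φ : PPFormula L) :
    ∃ r l, IsJoinTree φ.matrix φ.free ∅ φ.width r l := by
  classical
  induction φ with
  | top =>
    refine ⟨∅, [∅], .root, ?_, ?_, ?_, ?_⟩ <;> simp [free, matrix]
  | rel R x =>
    refine ⟨(rel R x).free.image .inl, [(rel R x).free.image .inl], .root, ?_, ?_, ?_, ?_⟩
    · intro b hb
      rw [List.mem_singleton.1 hb]
      exact Finset.card_image_le
    · intro b hb y hy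
      rw [List.mem_singleton.1 hb] at hy
      simpa using hy
    · exact fun y hy => Finset.mem_image_of_mem _ hy
    · rintro _ rfl
      refine ⟨_, List.mem_singleton_self _, fun i => Finset.mem_image_of_mem _ ?_⟩
      simp [free]
  | and φ ψ ihφ ihψ =>
    obtain ⟨r, l, h⟩ := ihφ
    obtain ⟨r', l', h'⟩ := ihψ
    have hV : (φ.free ∪ ψ.free).card ≤ (and φ ψ).width := le_max_left _ _
    have hk : φ.width ≤ (and φ ψ).width := (le_max_left _ _).trans (le_max_right _ _)
    have hk' : ψ.width ≤ (and φ ψ).width := (le_max_right _ _).trans (le_max_right _ _)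
    have := ((h.mono hk).newRoot hV Finset.subset_union_left (by simp)).union_sum
      ((h'.mono hk').newRoot hV Finset.subset_union_right (by simp)) (by simp)
    rw [Finset.union_empty] at this
    exact this
  | ex x φ ih =>
    obtain ⟨r, l, h⟩ := ih
    refine ⟨r.image (bindVar x), l.map (Finset.image (bindVar x)),
      h.running.map_injective (bindVar_injective x), fun b hb => ?_, fun b hb y hy => ?_,
      fun y hy => ?_, ?_⟩
    · obtain ⟨c, hc, rfl⟩ := List.mem_map.1 hb
      exact Finset.card_image_le.trans ((h.card_le c hc).trans (le_max_right _ _))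
    · obtain ⟨c, hc, rfl⟩ := List.mem_map.1 hb
      obtain ⟨z, hz, hzy⟩ := Finset.mem_image.1 hy
      obtain ⟨rfl, hne⟩ := bindVar_eq_inl.1 hzy
      have := h.mem c hc y hz
      simpa [free, hne] using this
    · obtain ⟨hne, hy⟩ := Finset.mem_erase.1 hy
      exact Finset.mem_image.2 ⟨_, h.mem_root y hy, bindVar_eq_inl.2 ⟨rfl, hne⟩⟩
    · rintro _ ⟨a, ha, rfl⟩
      obtain ⟨b, hb, hab⟩ := h.atom a ha
      exact ⟨_, List.mem_map_of_mem hb, fun i => Finset.mem_image_of_mem _ (hab i)⟩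

end PPFormula

/-! ### Flattening `♯PP`-formulas -/

namespace SharpPP

/-- Formulas without sums and constants. -/
def IsBasic : SharpPP L → Prop
  | cast _ _ => True
  | proj _ ψ => ψ.IsBasic
  | expand _ ψ => ψ.IsBasic
  | mul ψ θ => ψ.IsBasic ∧ θ.IsBasic
  | add _ _ => False
  | const _ => False

/-- A representation as a linear combination of formulas without sums and constants. -/
def flatten : SharpPP L → List (ℤ × SharpPP L)
  | cast φ V => [(1, cast φ V)]
  | proj V ψ => ψ.flatten.map fun p => (p.1, proj V p.2)
  | expand V ψ => ψ.flatten.map fun p => (p.1, expand V p.2)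
  | mul ψ θ => ψ.flatten.flatMap fun p => θ.flatten.map fun q => (p.1 * q.1, mul p.2 q.2)
  | add ψ θ => ψ.flatten ++ θ.flatten
  | const n => [(n, cast .top ∅)]

/-- Distributing over sums preserves free variables and can only shrink the set of closed ones, so
the formation rules survive and no width grows. -/
theorem flatten_spec (ψ : SharpPP L) (hψ : ψ.WellFormed) : ∀ p ∈ ψ.flatten,
    p.2.IsBasic ∧ p.2.WellFormed ∧ p.2.free = ψ.free ∧ p.2.closed ⊆ ψ.closed ∧
      p.2.sharpWidth ≤ ψ.sharpWidth ∧ p.2.width ≤ ψ.width := by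
  induction ψ with
  | cast φ V =>
    intro p hp
    rw [List.mem_singleton.1 hp]
    exact ⟨trivial, hψ, rfl, subset_rfl, le_rfl, le_rfl⟩
  | proj V ψ ih =>
    intro p hp
    obtain ⟨p, hp', rfl⟩ := List.mem_map.1 hp
    obtain ⟨hb, hw, hf, hc, hs, ht⟩ := ih hψ.1 p hp'
    have hf' : (proj V p.2).free = (proj V ψ).free := by simp only [free, hf]
    exact ⟨hb, ⟨hw, hψ.2.mono_right hc⟩, hf', Finset.union_subset_union_right hc,
      max_le_max (hf' ▸ le_rfl) hs, max_le_max (hf' ▸ le_rfl) ht⟩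
  | expand V ψ ih =>
    intro p hp
    obtain ⟨p, hp', rfl⟩ := List.mem_map.1 hp
    obtain ⟨hb, hw, hf, hc, hs, ht⟩ := ih hψ.1 p hp'
    have hf' : (expand V p.2).free = (expand V ψ).free := by simp only [free, hf]
    exact ⟨hb, ⟨hw, hψ.2.mono_right (hf ▸ Finset.union_subset_union_right hc)⟩, hf', hc,
      max_le_max (hf' ▸ le_rfl) hs, max_le_max (hf' ▸ le_rfl) ht⟩
  | mul ψ θ ihψ ihθ =>
    intro p hp
    obtain ⟨p, hp', hq⟩ := List.mem_flatMap.1 hp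
    obtain ⟨q, hq', rfl⟩ := List.mem_map.1 hq
    obtain ⟨hb, hw, hf, hc, hs, ht⟩ := ihψ hψ.1 p hp'
    obtain ⟨hb', hw', hf', hc', hs', ht'⟩ := ihθ hψ.2.1 q hq'
    have hff : (mul p.2 q.2).free = (mul ψ θ).free := hf
    refine ⟨⟨hb, hb'⟩, ⟨hw, hw', by rw [hf, hf', hψ.2.2.1], hψ.2.2.2.mono hc hc'⟩, hff,
      Finset.union_subset_union hc hc', max_le_max (hff ▸ le_rfl) (max_le_max hs hs'),
      max_le_max (hff ▸ le_rfl) (max_le_max ht ht')⟩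
  | add ψ θ ihψ ihθ =>
    intro p hp
    rcases List.mem_append.1 hp with hp | hp
    · obtain ⟨hb, hw, hf, hc, hs, ht⟩ := ihψ hψ.1 p hp
      exact ⟨hb, hw, hf, hc.trans Finset.subset_union_left,
        hs.trans ((le_max_left _ _).trans (le_max_right _ _)),
        ht.trans ((le_max_left _ _).trans (le_max_right _ _))⟩
    · obtain ⟨hb, hw, hf, hc, hs, ht⟩ := ihθ hψ.2.1 p hp
      exact ⟨hb, hw, hf.trans hψ.2.2.symm, hc.trans Finset.subset_union_right,
        hs.trans ((le_max_right _ _).trans (le_max_right _ _)),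
        ht.trans ((le_max_right _ _).trans (le_max_right _ _))⟩
  | const n =>
    intro p hp
    rw [List.mem_singleton.1 hp]
    simp [IsBasic, WellFormed, PPFormula.free, free, closed, sharpWidth, width, PPFormula.width]

theorem sum_listSum_comm {α β : Type*} [Fintype α] (l : List β) (f : α → β → ℤ) :
    ∑ x, (l.map (f x)).sum = (l.map fun p => ∑ x, f x p).sum := by
  induction l with
  | nil => simp
  | cons p l ih => simp [Finset.sum_add_distrib, ih]

theorem listSum_mul_listSum {α β : Type*} (l : List α) (l' : List β) (f : α → ℤ) (f' : β → ℤ) :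
    (l.map f).sum * (l'.map f').sum = (l.flatMap fun p => l'.map fun q => f p * f' q).sum := by
  induction l with
  | nil => simp
  | cons p l ih => simp [add_mul, ih, List.sum_map_mul_left]

theorem eval_eq_sum_flatten {B : Type} [Fintype B] [L.Structure B] (ψ : SharpPP L) :
    ∀ h : ℕ → B, ψ.eval h = (ψ.flatten.map fun p => p.1 * p.2.eval h).sum := by
  induction ψ with
  | cast φ V => intro h; simp [flatten]
  | proj V ψ ih =>
    intro h
    simp only [eval, ih, flatten, List.map_map]
    rw [sum_listSum_comm]
    simp only [← Finset.mul_sum]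
    rfl
  | expand V ψ ih =>
    intro h
    simp only [eval, ih, flatten, List.map_map]
    rfl
  | mul ψ θ ihψ ihθ =>
    intro h
    simp only [eval, ihψ, ihθ, flatten, listSum_mul_listSum, List.map_flatMap, List.map_map]
    refine congrArg List.sum (List.flatMap_congr fun p _ => List.map_congr_left fun q _ => ?_)
    simp only [Function.comp_apply, eval]
    ring
  | add ψ θ ihψ ihθ => intro h; simp [eval, ihψ, ihθ, flatten]
  | const n => intro h; simp [flatten, eval, PPFormula.Sat]

/-! ### Basic sentences count the answers of one query -/

/-- The conjunction of all formulas that are cast. -/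
def body : SharpPP L → PPFormula L
  | cast φ _ => φ
  | proj _ ψ => ψ.body
  | expand _ ψ => ψ.body
  | mul ψ θ => .and ψ.body θ.body
  -- The last two values are immaterial, as they do not arise in basic formulas.
  | add _ _ => .top
  | const _ => .top

theorem disjoint_free_closed (ψ : SharpPP L) (hψ : ψ.WellFormed) :
    Disjoint ψ.free ψ.closed := by
  induction ψ with
  | cast φ V => simp [closed]
  | proj V ψ ih =>
    exact Finset.disjoint_union_right.2 ⟨Finset.sdiff_disjoint,
      (ih hψ.1).mono_left Finset.sdiff_subset⟩
  | expand V ψ ih =>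
    exact Finset.disjoint_union_left.2 ⟨(Finset.disjoint_union_right.1 hψ.2).2, ih hψ.1⟩
  | mul ψ θ ihψ ihθ =>
    exact Finset.disjoint_union_right.2 ⟨ihψ hψ.1, hψ.2.2.1 ▸ ihθ hψ.2.1⟩
  | add ψ θ ihψ ihθ =>
    exact Finset.disjoint_union_right.2 ⟨ihψ hψ.1, hψ.2.2 ▸ ihθ hψ.2.1⟩
  | const n => simp [closed]

theorem free_body_subset (ψ : SharpPP L) (hψ : ψ.WellFormed) :
    ψ.body.free ⊆ ψ.free ∪ ψ.closed := by
  induction ψ with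
  | cast φ V => exact hψ.trans Finset.subset_union_left
  | proj V ψ ih =>
    intro x hx
    have := ih hψ.1 hx
    simp only [free, closed, Finset.mem_union, Finset.mem_sdiff] at this ⊢
    tauto
  | expand V ψ ih =>
    intro x hx
    have := ih hψ.1 hx
    simp only [free, closed, Finset.mem_union] at this ⊢
    tauto
  | mul ψ θ ihψ ihθ =>
    intro x hx
    have h₁ : x ∈ _ → _ := fun h => ihψ hψ.1 h
    have h₂ : x ∈ _ → _ := fun h => ihθ hψ.2.1 h
    rw [← hψ.2.2.1] at h₂
    simp only [body, PPFormula.free, free, closed, Finset.mem_union] at hx h₁ h₂ ⊢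
    tauto
  | add ψ θ ihψ ihθ => simp [body, PPFormula.free]
  | const n => simp [body, PPFormula.free]

-- All projections merge into one sum over the closed variables. For a product, the closed variables
-- of one factor are disjoint from those of the other and from the common free variables, so each
-- factor ignores them and the product of sums is a sum over joint assignments. Closed variables
-- absent from the body contribute factors `|B|`, as liberal variables without atoms do.
open Classical in
theorem eval_eq_sum_body {B : Type} [Fintype B] [L.Structure B] (ψ : SharpPP L)
    (hb : ψ.IsBasic) (hψ : ψ.WellFormed) : ∀ h : ℕ → B, ψ.eval h =
      ∑ g : ψ.closed → B, if ψ.body.Sat (override h ψ.closed g) then 1 else 0 := by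
  induction ψ with
  | cast φ V =>
    intro h
    have : ∀ g : (∅ : Finset ℕ) → B, override h ∅ g = h := fun g =>
      funext fun x => override_of_notMem _ _ (by simp)
    change _ = ∑ g : (∅ : Finset ℕ) → B, if φ.Sat (override h ∅ g) then (1 : ℤ) else 0
    simp only [this]
    rw [Fintype.sum_unique]
    rfl
  | proj V ψ ih =>
    intro h
    simp only [eval, ih hb hψ.1]
    rw [← sum_override_union hψ.2.symm h fun g => if ψ.body.Sat g then 1 else 0,
      Finset.union_comm]
    rfl
  | expand V ψ ih => exact ih hb hψ.1
  | mul ψ θ ihψ ihθ =>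
    intro h
    simp only [eval, ihψ hb.1 hψ.1, ihθ hb.2 hψ.2.1]
    change _ = ∑ g : ↥(ψ.closed ∪ θ.closed) → B,
      if (PPFormula.and ψ.body θ.body).Sat (override h (ψ.closed ∪ θ.closed) g) then (1 : ℤ) else 0
    rw [sum_override_union hψ.2.2.2 h
      fun g => if (PPFormula.and ψ.body θ.body).Sat g then (1 : ℤ) else 0,
      mul_comm, Finset.sum_mul_sum]
    refine Finset.sum_congr rfl fun g _ => Finset.sum_congr rfl fun g' _ => ?_
    have h₁ : ψ.body.Sat (override (override h θ.closed g) ψ.closed g') ↔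
        ψ.body.Sat (override h ψ.closed g') := by
      refine PPFormula.sat_congr _ fun x hx => ?_
      by_cases hxc : x ∈ ψ.closed
      · rw [override_of_mem _ _ hxc, override_of_mem _ _ hxc]
      · have hxf := (Finset.mem_union.1 (ψ.free_body_subset hψ.1 hx)).resolve_right hxc
        rw [override_of_notMem _ _ hxc, override_of_notMem _ _ hxc, override_of_notMem]
        rw [hψ.2.2.1] at hxf
        exact Finset.disjoint_left.1 (θ.disjoint_free_closed hψ.2.1) hxf
    have h₂ : θ.body.Sat (override (override h θ.closed g) ψ.closed g') ↔
        θ.body.Sat (override h θ.closed g) := by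
      refine PPFormula.sat_congr _ fun x hx => override_of_notMem _ _ ?_
      rcases Finset.mem_union.1 (θ.free_body_subset hψ.2.1 hx) with hx | hx
      · rw [← hψ.2.2.1] at hx
        exact Finset.disjoint_left.1 (ψ.disjoint_free_closed hψ.1) hx
      · exact Finset.disjoint_right.1 hψ.2.2.2 hx
    simp only [PPFormula.Sat, h₁, h₂]
    by_cases hs : ψ.body.Sat (override h ψ.closed g') <;> simp [hs]
  | add ψ θ ihψ ihθ => exact hb.elim
  | const n => exact hb.elim

theorem eval_eq_count (ψ : SharpPP L) (hb : ψ.IsBasic) (hψ : ψ.WellFormed) (hf : ψ.free = ∅)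
    (M : FinStr L) (h : ℕ → M.B) : ψ.eval h = (ψ.body.toQuery ψ.closed).count M := by
  classical
  have hsub : ψ.body.free ⊆ ψ.closed := by simpa [hf] using ψ.free_body_subset hψ
  rw [eval_eq_sum_body ψ hb hψ, Finset.sum_boole, Query.count]
  have hmem : ∀ f : ψ.closed → M.B, f ∈ (ψ.body.toQuery ψ.closed).answers M.B ↔
      f ∈ ((Finset.univ.filter fun g : ψ.closed → M.B =>
        ψ.body.Sat (override h ψ.closed g) : Finset _) : Set (ψ.closed → M.B)) := fun f =>
    (PPFormula.mem_answers_toQuery hsub h f).trans (by simp)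
  exact congrArg Nat.cast
    ((congrArg Set.ncard (Set.ext hmem)).trans (Set.ncard_coe_finset _)).symm

/-- A representable formula has the same numbers of answers as the query of a basic formula. -/
theorem Represents.exists_isBasic [L.IsRelational] {ψ : SharpPP L} {φ : PrenexPP L}
    (h : ψ.Represents φ) : ∃ θ : SharpPP L, θ.IsBasic ∧ θ.WellFormed ∧ θ.free = ∅ ∧
      θ.sharpWidth ≤ ψ.sharpWidth ∧ θ.width ≤ ψ.width ∧
      ∀ M, φ.toQuery.count M = (θ.body.toQuery θ.closed).count M := by
  obtain ⟨hw, hf, he⟩ := h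
  have hspec := ψ.flatten_spec hw
  obtain ⟨p, hp, hcount⟩ := Query.exists_count_eq_of_linearCombination φ.toQuery
    (ψ.flatten.map fun p => (p.1, p.2.body.toQuery p.2.closed)) fun M => by
      have h₀ : ℕ → M.B := fun _ => Classical.arbitrary _
      have hφ : φ.toQuery.count M = (φ.answers M.B).ncard :=
        congrArg Set.ncard (φ.answers_toQuery M.B)
      rw [hφ, ← he M.B h₀, eval_eq_sum_flatten, List.map_map]
      congr 1
      refine List.map_congr_left fun p hp => ?_
      obtain ⟨hb, hw', hf', -⟩ := hspec p hp
      rw [eval_eq_count p.2 hb hw' (hf'.trans hf)]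
      rfl
  obtain ⟨p, hp', rfl⟩ := List.mem_map.1 hp
  obtain ⟨hb, hw', hf', -, hs, ht⟩ := hspec p hp'
  exact ⟨p.2, hb, hw', hf'.trans hf, hs, ht, hcount⟩

/-! ### Join trees read off from basic formulas -/

/-- The atoms of a basic formula have a join tree of the width of the formula. -/
theorem exists_isJoinTree (ψ : SharpPP L) (hb : ψ.IsBasic) (hψ : ψ.WellFormed) :
    ∃ r l, PPFormula.IsJoinTree ψ.body.matrix ψ.free ψ.closed ψ.width r l := by
  classical
  induction ψ with
  | cast φ V =>
    obtain ⟨r, l, h⟩ := φ.exists_isJoinTree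
    exact ⟨_, _, (h.mono (le_max_right _ _)).newRoot (le_max_left _ _) hψ (by simp)⟩
  | proj V ψ ih =>
    obtain ⟨r, l, h⟩ := ih hb hψ.1
    -- A projection only moves variables from the free to the closed ones, so the tree is unchanged.
    refine ⟨r, l, h.running, fun b hb => (h.card_le b hb).trans (le_max_right _ _),
      fun b hb y hy => ?_, fun y hy => h.mem_root y (Finset.sdiff_subset hy), h.atom⟩
    have := h.mem b hb y hy
    simp only [free, closed, Finset.mem_union, Finset.mem_sdiff] at this ⊢
    tauto
  | expand V ψ ih =>
    obtain ⟨r, l, h⟩ := ih hb hψ.1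
    exact ⟨_, _, (h.mono (le_max_right _ _)).newRoot (le_max_left _ _)
      Finset.subset_union_right (disjoint_free_closed (expand V ψ) hψ)⟩
  | mul ψ θ ihψ ihθ =>
    obtain ⟨r, l, h⟩ := ihψ hb.1 hψ.1
    obtain ⟨r', l', h'⟩ := ihθ hb.2 hψ.2.1
    rw [← hψ.2.2.1] at h'
    exact (h.mono ((le_max_left _ _).trans (le_max_right _ _))).union_sum
      (h'.mono ((le_max_right _ _).trans (le_max_right _ _))) hψ.2.2.2
  | add ψ θ ihψ ihθ => exact hb.elim
  | const n => exact hb.elim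

/-- A join tree for the liberal variables of a basic formula, in which each quantified variable is
assigned a bag that contains all liberal variables that it appears with. -/
theorem exists_liberal_joinTree (ψ : SharpPP L) (hb : ψ.IsBasic) (hψ : ψ.WellFormed) :
    ∃ r l, RunningIntersection r l ∧ (∀ b ∈ l, b.card ≤ ψ.sharpWidth) ∧
      (∀ b ∈ l, b ⊆ ψ.free ∪ ψ.closed) ∧ ψ.free ⊆ r ∧
      ∃ β : ψ.body.QVar → Finset ℕ, (∀ q, β q ∈ l) ∧ ∀ a ∈ ψ.body.matrix, ∃ b ∈ l, ∀ i,
        (∀ y, a.args i = .inl y → y ∈ b) ∧ ∀ q, a.args i = .inr q → β q = b := by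
  induction ψ with
  | cast φ V =>
    -- All quantified variables of a cast formula are assigned the single bag `V`, however large the
    -- formula inside is; this is why `sharpWidth` suffices.
    refine ⟨V, [V], .root, by simp [sharpWidth, free], by simp [free, closed], subset_rfl,
      fun _ => V, by simp, fun a ha => ⟨V, by simp, fun i => ⟨fun y hy => ?_, fun _ _ => rfl⟩⟩⟩
    exact hψ (φ.mem_free_of_mem_matrix a ha i y hy)
  | proj V ψ ih =>
    obtain ⟨r, l, h, hk, hl, hr, hβ⟩ := ih hb hψ.1
    refine ⟨r, l, h, fun b hb => (hk b hb).trans (le_max_right _ _), fun b hb => ?_,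
      Finset.sdiff_subset.trans hr, hβ⟩
    refine (hl b hb).trans fun x hx => ?_
    simp only [free, closed, Finset.mem_union, Finset.mem_sdiff] at hx ⊢
    tauto
  | expand V ψ ih =>
    obtain ⟨r, l, h, hk, hl, hr, β, hβl, hβ⟩ := ih hb hψ.1
    refine ⟨V ∪ ψ.free, l ++ [V ∪ ψ.free], ?_, ?_, ?_, subset_rfl, β,
      fun q => List.mem_append_left _ (hβl q), fun a ha => ?_⟩
    · refine RunningIntersection.root.append (p := V ∪ ψ.free) h (by simp) fun b hb b' hb' x hx hx' => ?_
      rw [List.mem_singleton] at hb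
      subst hb
      refine ⟨hx, ?_⟩
      rcases Finset.mem_union.1 hx with hxV | hx
      · exact absurd (hl b' hb' hx') (Finset.disjoint_left.1 hψ.2 hxV)
      · exact hr hx
    · intro b hb
      rcases List.mem_append.1 hb with hb | hb
      · exact (hk b hb).trans (le_max_right _ _)
      · rw [List.mem_singleton.1 hb]
        exact le_max_left _ _
    · intro b hb
      rcases List.mem_append.1 hb with hb | hb
      · exact (hl b hb).trans (Finset.union_subset_union_left Finset.subset_union_right)
      · rw [List.mem_singleton.1 hb]
        exact Finset.subset_union_left
    · obtain ⟨b, hb, hab⟩ := hβ a ha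
      exact ⟨b, List.mem_append_left _ hb, hab⟩
  | mul ψ θ ihψ ihθ =>
    obtain ⟨r, l, h, hk, hl, hr, β, hβl, hβ⟩ := ihψ hb.1 hψ.1
    obtain ⟨r', l', h', hk', hl', hr', β', hβl', hβ'⟩ := ihθ hb.2 hψ.2.1
    rw [← hψ.2.2.1] at hl' hr'
    refine ⟨r, l' ++ l, h.append h' h.root_mem fun b hb b' hb' x hx hx' => ?_, ?_, ?_, hr,
      Sum.elim β β', ?_, ?_⟩
    · have h₁ := hl b hb hx
      have h₂ := hl' b' hb' hx'
      rw [Finset.mem_union] at h₁ h₂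
      have : x ∈ ψ.closed → x ∉ θ.closed := fun h => Finset.disjoint_left.1 hψ.2.2.2 h
      have : x ∈ ψ.free := by tauto
      exact ⟨hr this, hr' this⟩
    · intro b hb
      rcases List.mem_append.1 hb with hb | hb
      · exact (hk' b hb).trans ((le_max_right _ _).trans (le_max_right _ _))
      · exact (hk b hb).trans ((le_max_left _ _).trans (le_max_right _ _))
    · intro b hb
      rcases List.mem_append.1 hb with hb | hb
      · exact (hl' b hb).trans (Finset.union_subset_union_right Finset.subset_union_right)
      · exact (hl b hb).trans (Finset.union_subset_union_right Finset.subset_union_left)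
    · rintro (q | q)
      · exact List.mem_append_right _ (hβl q)
      · exact List.mem_append_left _ (hβl' q)
    · rintro _ (⟨a, ha, rfl⟩ | ⟨a, ha, rfl⟩)
      · obtain ⟨b, hb, hab⟩ := hβ a ha
        refine ⟨b, List.mem_append_right _ hb, fun i => ⟨fun y hy => (hab i).1 y
          (PPFormula.eq_inl_of_sumMap_eq_inl hy), fun q hq => ?_⟩⟩
        change Sum.map id Sum.inl (a.args i) = Sum.inr q at hq
        rcases hi : a.args i with y | q'
        · rw [hi] at hq
          cases hq
        · rw [hi] at hq
          cases hq
          exact (hab i).2 q' hi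
      · obtain ⟨b, hb, hab⟩ := hβ' a ha
        refine ⟨b, List.mem_append_left _ hb, fun i => ⟨fun y hy => (hab i).1 y
          (PPFormula.eq_inl_of_sumMap_eq_inl hy), fun q hq => ?_⟩⟩
        change Sum.map id Sum.inr (a.args i) = Sum.inr q at hq
        rcases hi : a.args i with y | q'
        · rw [hi] at hq
          cases hq
        · rw [hi] at hq
          cases hq
          exact (hab i).2 q' hi
  | add ψ θ ihψ ihθ => exact hb.elim
  | const n => exact hb.elim

end SharpPP

end SharpLogic

namespace SharpLogic

variable {L : FirstOrder.Language.{0, v}}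

/-! ### From representations to bounds on the treewidth -/

namespace PrenexPP

/-- The treewidth of a core is bounded by the width of each representation. -/
theorem IsCore.treewidth_graph_le [L.IsRelational] {ψ φ : PrenexPP L} (hψ : ψ.IsCore φ)
    {θ : SharpPP L} (hθ : θ.Represents φ) {k : ℕ} (hk : 1 ≤ k) (hw : θ.width ≤ k) :
    treewidth ψ.graph ≤ k := by
  -- The empty case is separate because structures have nonempty universes.
  rcases φ.dom.eq_empty_or_nonempty with hφ | hφ
  · have : IsEmpty ψ.dom := ⟨fun x => by simpa [hφ] using hψ.dom_subset x.2⟩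
    exact (RunningIntersection.root (r := ∅)).treewidth_le (fun x => isEmptyElim x) hk (by simp)
  · obtain ⟨β, hb, hwf, hf, -, hβw, hcount⟩ := hθ.exists_isBasic
    have : Nonempty (β.body.toQuery β.closed).X := ⟨.inr (Classical.arbitrary β.body.QVar)⟩
    obtain ⟨e, he, -, hat⟩ := hψ.exists_injective hcount hφ
    obtain ⟨r, l, h⟩ := β.exists_isJoinTree hb hwf
    refine treewidth_le_of_injective h.running (f := Sum.map Subtype.val id ∘ e)
      ((Subtype.val_injective.sumMap Function.injective_id).comp he) ?_ hk
      fun b hb => (h.card_le b hb).trans (hβw.trans hw)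
    rintro x y ⟨-, a, ha, ⟨i, hi⟩, j, hj⟩
    obtain ⟨b, hb, hab⟩ := h.atom _
      (hat ⟨a.arity, a.rel, fun i => ⟨a.args i, ψ.args_mem a ha i⟩⟩ ha)
    have hx : (⟨a.args i, ψ.args_mem a ha i⟩ : ψ.dom) = x := Subtype.ext hi
    have hy : (⟨a.args j, ψ.args_mem a ha j⟩ : ψ.dom) = y := Subtype.ext hj
    exact ⟨b, hb, hx ▸ hab i, hy ▸ hab j⟩

/-- The treewidth of the contraction of a core is bounded by the `♯`-width of each
representation. -/
theorem IsCore.treewidth_contract_le [L.IsRelational] {ψ φ : PrenexPP L} (hψ : ψ.IsCore φ)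
    {θ : SharpPP L} (hθ : θ.Represents φ) {k : ℕ} (hk : 1 ≤ k) (hw : θ.sharpWidth ≤ k) :
    treewidth ψ.contract ≤ k := by
  rcases φ.dom.eq_empty_or_nonempty with hφ | hφ
  · have : IsEmpty ψ.lib :=
      ⟨fun x => by simpa [hφ] using hψ.dom_subset (ψ.lib_subset x.2)⟩
    exact (RunningIntersection.root (r := ∅)).treewidth_le (fun x => isEmptyElim x) hk (by simp)
  · obtain ⟨β, hb, hwf, hf, hβw, -, hcount⟩ := hθ.exists_isBasic
    have : Nonempty (β.body.toQuery β.closed).X := ⟨.inr (Classical.arbitrary β.body.QVar)⟩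
    obtain ⟨e, he, hlib, hat⟩ := hψ.exists_injective hcount hφ
    obtain ⟨r, l, h, hcard, -, -, bag, hbagl, hbag⟩ := β.exists_liberal_joinTree hb hwf
    let E : ψ.dom → ℕ ⊕ β.body.QVar := Sum.map Subtype.val id ∘ e
    have hE : Function.Injective E :=
      (Subtype.val_injective.sumMap Function.injective_id).comp he
    have hElib : ∀ s : ψ.lib, ∃ y, E (ψ.ofLib s) = .inl y := fun s => by
      obtain ⟨t, ht⟩ := (hlib (ψ.ofLib s)).1 s.2
      refine ⟨Subtype.val (p := (· ∈ β.closed)) t, ?_⟩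
      change Sum.map Subtype.val id (e (ψ.ofLib s)) = _
      rw [← ht]
      rfl
    have hEq : ∀ x : ψ.dom, (x : ℕ) ∉ ψ.lib → ∃ q, E x = .inr q := fun x hx => by
      rcases hex : e x with t | q
      · exact absurd ((hlib x).2 ⟨t, hex.symm⟩) hx
      · refine ⟨q, ?_⟩
        change Sum.map Subtype.val id (e x) = _
        rw [hex]
        rfl
    choose f hf using hElib
    have hfinj : Function.Injective f := fun s t hst => by
      have : ψ.ofLib s = ψ.ofLib t := hE (by rw [hf, hf, hst])
      exact Subtype.ext (congrArg (fun x : ψ.dom => (x : ℕ)) this)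
    have hadj : ∀ x y : ψ.dom, ψ.graph.Adj x y → ∃ b ∈ l,
        ((∀ z, E x = .inl z → z ∈ b) ∧ ∀ q, E x = .inr q → bag q = b) ∧
        ((∀ z, E y = .inl z → z ∈ b) ∧ ∀ q, E y = .inr q → bag q = b) := by
      rintro x y ⟨-, a, ha, ⟨i, hi⟩, j, hj⟩
      obtain ⟨b, hb, hab⟩ := hbag _
        (hat ⟨a.arity, a.rel, fun i => ⟨a.args i, ψ.args_mem a ha i⟩⟩ ha)
      have hx : (⟨a.args i, ψ.args_mem a ha i⟩ : ψ.dom) = x := Subtype.ext hi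
      have hy : (⟨a.args j, ψ.args_mem a ha j⟩ : ψ.dom) = y := Subtype.ext hj
      subst hx hy
      exact ⟨b, hb, hab i, hab j⟩
    choose Q hQ using hEq
    -- Adjacent quantified variables are assigned the same bag, so a whole component has one bag. It
    -- contains every liberal variable adjacent to the component, and thus covers the edges that the
    -- contraction adds.
    have hcomp : ∀ y y' : ψ.quantified, (ψ.graph.induce ψ.quantified).Reachable y y' →
        bag (Q y y.2) = bag (Q y' y'.2) := by
      rintro y y' ⟨p⟩
      induction p with
      | nil => rfl
      | @cons u v w huv _ ih =>
        obtain ⟨b, -, hu, hv⟩ := hadj _ _ huv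
        rw [← ih, hu.2 _ (hQ _ u.2), hv.2 _ (hQ _ v.2)]
    have hmem : ∀ (s : ψ.lib) (V : (ψ.graph.induce ψ.quantified).ConnectedComponent),
        ψ.ofLib s ∈ ψ.existsComponent V → ∃ y ∈ V.supp, f s ∈ bag (Q y y.2) := by
      rintro s V (⟨y, -, hys⟩ | ⟨-, y, hy, hsy⟩)
      · exact absurd (hys ▸ s.2 : ((y : ψ.dom) : ℕ) ∈ ψ.lib) y.2
      · obtain ⟨b, -, hs, hy'⟩ := hadj _ _ hsy
        exact ⟨y, hy, hy'.2 _ (hQ _ y.2) ▸ hs.1 _ (hf s)⟩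
    refine treewidth_le_of_injective h hfinj ?_ hk fun b hb => (hcard b hb).trans (hβw.trans hw)
    rintro s t ⟨-, hst | ⟨V, hs, ht⟩⟩
    · obtain ⟨b, hb, hs, ht⟩ := hadj _ _ hst
      exact ⟨b, hb, hs.1 _ (hf s), ht.1 _ (hf t)⟩
    · obtain ⟨y, hy, hsy⟩ := hmem s V hs
      obtain ⟨y', hy', hty⟩ := hmem t V ht
      refine ⟨_, hbagl (Q y y.2), hsy, ?_⟩
      rw [hcomp y y' (V.reachable_of_mem_supp hy hy')]
      exact hty

/-- Bounds on the treewidth of the contraction and of the graph of a core yield a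
representation of bounded width. -/
theorem IsCore.exists_represents {ψ φ : PrenexPP L} (hψ : ψ.IsCore φ) {k m : ℕ}
    (hk : treewidth ψ.contract ≤ k) (hm : treewidth ψ.graph ≤ m) :
    ∃ θ : SharpPP L, θ.Represents φ ∧ θ.sharpWidth ≤ k + 1 ∧ θ.width ≤ (k + 1) + (m + 1) := by
  obtain ⟨r, l, h, hl, hcov, hadj⟩ := exists_runningIntersection_of_treewidth_le hk
  obtain ⟨r', l', h', hl', hcov', hadj'⟩ := exists_runningIntersection_of_treewidth_le hm
  obtain ⟨θ, hθ, hs, hw⟩ := ψ.exists_represents h (fun b hb => by exact_mod_cast hl b hb) hcov hadj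
    h' (fun b hb => by exact_mod_cast hl' b hb) hcov' hadj'
  exact ⟨θ, hψ.represents hθ, hs, hw⟩

end PrenexPP

theorem SharpPP.sharpWidth_le_width (ψ : SharpPP L) : ψ.sharpWidth ≤ ψ.width := by
  induction ψ with
  | cast φ V => exact le_max_left _ _
  | proj V ψ ih => exact max_le_max le_rfl ih
  | expand V ψ ih => exact max_le_max le_rfl ih
  | mul ψ θ ihψ ihθ => exact max_le_max le_rfl (max_le_max ihψ ihθ)
  | add ψ θ ihψ ihθ => exact max_le_max le_rfl (max_le_max ihψ ihθ)
  | const n => exact le_rfl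

theorem contractionCondition_of_sharpWidth_le {Φ : PPClass.{v}} {k : ℕ} (hk : 1 ≤ k)
    (h : ∀ p ∈ Φ, ∃ ψ : SharpPP p.1.1, ψ.Represents p.2 ∧ ψ.sharpWidth ≤ k) :
    ContractionCondition Φ := by
  refine ⟨k, ?_⟩
  rintro _ ⟨p, hp, ψ, hψ, rfl⟩
  obtain ⟨θ, hθ, hw⟩ := h p hp
  have : p.1.1.IsRelational := p.1.2
  exact hψ.treewidth_contract_le hθ hk hw

end SharpLogic

/-! ### The main theorem -/

theorem theorem4p1 (Φ : SharpLogic.PPClass.{v}) :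
    (SharpLogic.TractabilityCondition Φ ↔
      ∃ k : ℕ, 1 ≤ k ∧ ∀ p ∈ Φ, ∃ ψ : SharpLogic.SharpPP p.1.1,
        ψ.Represents p.2 ∧ ψ.width ≤ k) ∧
    (SharpLogic.ContractionCondition Φ ↔
      ∃ k : ℕ, 1 ≤ k ∧ ∀ p ∈ Φ, ∃ ψ : SharpLogic.SharpPP p.1.1,
        ψ.Represents p.2 ∧ ψ.sharpWidth ≤ k) := by
  refine ⟨⟨?_, ?_⟩, ?_, ?_⟩
  · rintro ⟨⟨k, hk⟩, m, hm⟩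
    -- Bags have one element more than the treewidth; `toNat` replaces integer bounds that may be
    -- negative.
    refine ⟨(k.toNat + 1) + (m.toNat + 1), by omega, fun p hp => ?_⟩
    obtain ⟨ψ, hψ⟩ := p.2.exists_isCore
    obtain ⟨θ, hθ, -, hw⟩ := hψ.exists_represents
      ((hk _ ⟨p, hp, ψ, hψ, rfl⟩).trans (Int.self_le_toNat k))
      ((hm _ ⟨p, hp, ψ, hψ, rfl⟩).trans (Int.self_le_toNat m))
    exact ⟨θ, hθ, hw⟩
  · rintro ⟨k, hk, h⟩
    refine ⟨SharpLogic.contractionCondition_of_sharpWidth_le hk fun p hp => ?_, k, ?_⟩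
    · obtain ⟨θ, hθ, hw⟩ := h p hp
      exact ⟨θ, hθ, θ.sharpWidth_le_width.trans hw⟩
    · rintro _ ⟨p, hp, ψ, hψ, rfl⟩
      obtain ⟨θ, hθ, hw⟩ := h p hp
      have : p.1.1.IsRelational := p.1.2
      exact hψ.treewidth_graph_le hθ hk hw
  · rintro ⟨k, hk⟩
    refine ⟨k.toNat + 1, by omega, fun p hp => ?_⟩
    obtain ⟨ψ, hψ⟩ := p.2.exists_isCore
    -- The treewidth of the graph itself serves as `m`: it is not uniformly bounded, but it only
    -- enters the bound on `width`, which is dropped.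
    obtain ⟨θ, hθ, hw, -⟩ := hψ.exists_represents
      ((hk _ ⟨p, hp, ψ, hψ, rfl⟩).trans (Int.self_le_toNat k))
      (Int.self_le_toNat (SharpLogic.treewidth ψ.graph))
    exact ⟨θ, hθ, hw⟩
  · rintro ⟨k, hk, h⟩
    exact SharpLogic.contractionCondition_of_sharpWidth_le hk h
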